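/- Let $n\ge 1$ be an integer and let $p,q$ be real numbers with $1<p\le 2$ and $1<q\le p-1+\frac pn$. Let $\mathbb S=(0,\infty)\times\mathbb R^n$ and consider the equation $$w_t-\Delta_p w=|w|^{q-1}w,\qquad \Delta_p w=\operatorname{div}_x\bigl(|\nabla_x w|^{p-2}\nabla_x w\bigr).\tag{$*$}$$ A measurable function $u:\mathbb S\to\mathbb R$ is called an entire weak super-solution of $(*)$ if $u\in L_{q,\mathrm{loc}}(\mathbb S)$, $u$ has weak (distributional) derivatives $u_t$ and $\nabla_x u=(u_{x_1},\dots,u_{x_n})$ in $\mathbb S$ with $u_t\in L_{1,\mathrm{loc}}(\mathbb S)$ and $|\nabla_x u|^p\in L_{1,\mathrm{loc}}(\mathbb S)$, and $$\int_{\mathbb S}\Bigl[u_t\varphi+\sum_{i=1}^n|\nabla_x u|^{p-2}u_{x_i}\varphi_{x_i}-|u|^{q-1}u\,\varphi\Bigr]\,dt\,dx\ \ge 0$$ for every non-negative $\varphi\in C^\infty(\mathbb S)$ with compact support in $\mathbb S$. (Here $|\cdot|$ is the Euclidean norm, $|\xi|^{p-2}\xi$ is read as $0$ at $\xi=0$,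 and all local spaces refer to compact subsets of the open set $\mathbb S$, so that nothing is required at $t=0$ or at infinity.) A function $v$ is called an entire weak sub-solution of $(*)$ if $-v$ is an entire weak super-solution of $(*)$. Theorem. If $u$ is an entire weak super-solution and $v$ an entire weak sub-solution of $(*)$ in $\mathbb S$ such that $u\ge v$ almost everywhere in $\mathbb S$, then $u=v$ almost everywhere in $\mathbb S$. -/

import Mathlib

open MeasureTheory TopologicalSpace

noncomputable section

/-- Space-time `ℝ × ℝⁿ`; points are `z = (t, x)`, with Lebesgue measure `volume = dt dx`. -/
abbrev SpaceTime (n : ℕ) : Type := ℝ × EuclideanSpace ℝ (Fin n)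

/-- The open half-space `𝕊 = (0, ∞) × ℝⁿ`. -/
def halfSpace (n : ℕ) : Opens (SpaceTime n) where
  carrier := Set.Ioi 0 ×ˢ Set.univ
  is_open' := isOpen_Ioi.prod isOpen_univ

/-- Direction of the time variable `t`. -/
def timeDir (n : ℕ) : SpaceTime n := (1, 0)

/-- Direction of the space variable `xᵢ`. -/
def spaceDir {n : ℕ} (i : Fin n) : SpaceTime n := (0, EuclideanSpace.single i 1)

/-- `g` is the weak (distributional) derivative of `f` in the direction `e` on the open set `Ω`,
both functions being locally integrable in `Ω`. -/
def HasWeakDirDeriv {E : Type*} [NormedAddCommGroup E] [NormedSpace ℝ E] [MeasureSpace E]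
    (Ω : Opens E) (e : E) (f g : E → ℝ) : Prop :=
  LocallyIntegrableOn f Ω ∧ LocallyIntegrableOn g Ω ∧
    ∀ φ : TestFunction Ω ℝ (⊤ : ℕ∞),
      ∫ z in Ω, f z * fderiv ℝ φ z e = - ∫ z in Ω, g z * φ z

/-- Entire weak super-solutions of `w_t - Δ_p w = |w|^(q-1) w` in the half-space `𝕊`.
Here `ut` is the weak time derivative `u_t` and `Du` the weak spatial gradient `∇ₓ u`
(both are determined almost everywhere in `𝕊` by `u`), and `‖Du z‖` is the Euclidean norm. -/
def IsEntireWeakSuperSolution (n : ℕ) (p q : ℝ) (u : SpaceTime n → ℝ) : Prop :=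
  AEStronglyMeasurable u (volume.restrict (halfSpace n : Set (SpaceTime n))) ∧
  LocallyIntegrableOn (fun z => |u z| ^ q) (halfSpace n) ∧
  ∃ (ut : SpaceTime n → ℝ) (Du : SpaceTime n → EuclideanSpace ℝ (Fin n)),
    HasWeakDirDeriv (halfSpace n) (timeDir n) u ut ∧
    (∀ i : Fin n, HasWeakDirDeriv (halfSpace n) (spaceDir i) u (fun z => Du z i)) ∧
    LocallyIntegrableOn (fun z => ‖Du z‖ ^ p) (halfSpace n) ∧
    ∀ φ : TestFunction (halfSpace n) ℝ (⊤ : ℕ∞), (∀ z, 0 ≤ φ z) →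
      0 ≤ ∫ z in (halfSpace n : Set (SpaceTime n)),
        (ut z * φ z
          + ∑ i : Fin n, ‖Du z‖ ^ (p - 2) * Du z i * fderiv ℝ φ z (spaceDir i)
          - |u z| ^ (q - 1) * u z * φ z)

/-- `v` is an entire weak sub-solution if `-v` is an entire weak super-solution. -/
def IsEntireWeakSubSolution (n : ℕ) (p q : ℝ) (v : SpaceTime n → ℝ) : Prop :=
  IsEntireWeakSuperSolution n p q (fun z => -v z)

end

/-! ### Elementary inequalities -/

/-! The difference w = u - v ≥ 0 satisfies w_t - div A ≥ G, where A is the difference of the two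
fluxes and G that of the two sources. Write F = A · ∇w. Three structural facts suffice: G ≥ c w^q
(`abs_rpow_mul_sub_ge`), F ≥ 0, and |A| ≤ K F^((p-1)/p). The last two follow from
`norm_pLaplace_flux_sub_rpow_le`, where p ≤ 2 enters because the dual exponent p/(p-1) is then at
least 2. Thus w behaves like a non-negative super-solution of one equation, and a Fujita-type test
function argument applies. These facts are collected in `IsDifferenceSystem`.

The natural scaling for w of size r is T = r^(1-q), R = r^(-(q-p+1)/p). On a cylinder Q of these
dimensions, testing with (w + l r)^(-s) η^k and absorbing the errors by Young's inequality bounds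
the weighted dissipation: r^s ∫ (w + l r)^(-s-1) F η^k ≤ C r^q |Q|
(`exists_integral_weighted_dissipation_le`). Testing with η^k alone leaves a flux term which Young's
inequality splits into this dissipation and a power of w lower than q; hence ∫ w^q η^k ≤ C r^q |Q|
(`exists_integral_rpow_le`). Up to a constant, r^q |Q| = r^q T R^n = r R^n = R^(n - p/(q-p+1)),
which stays bounded as R → ∞ exactly when q ≤ p - 1 + p/n. So w^q is integrable on the half-space.

In the critical case this bound does not tend to zero. However, the errors arise only where the
cutoff decreases, which is far away, and they can be bounded by κ r^q |Q| + C ∫ w^q over the far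
region, with κ arbitrary (`exists_integral_rpow_le_far`). The last integral is a tail of a
convergent one and tends to 0; letting κ → 0 gives ∫ w^q = 0 (`IsDifferenceSystem.ae_eq_zero`). No
initial condition is needed, since the rise of the cutoff near t = 0 contributes with the favourable
sign.

The nonlinear test functions are justified by mollifying w inside the test function only
(`integral_comp_test_nonneg`). -/

theorem exists_rpow_le_mul_rpow_add {α γ δ : ℝ} (hα : 0 ≤ α) (h : α < γ) (hδ : 0 < δ) :
    ∃ C : ℝ, 0 ≤ C ∧ ∀ x : ℝ, 0 ≤ x → x ^ α ≤ δ * x ^ γ + C := by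
  -- The threshold is the point where x^α = δ x^γ; below it x^α is bounded, above it the higher
  -- power wins.
  have hM : 0 < δ ^ (-(1 / (γ - α))) := Real.rpow_pos_of_pos hδ _
  refine ⟨(δ ^ (-(1 / (γ - α)))) ^ α, by positivity, fun x hx => ?_⟩
  have hγ : 0 ≤ δ * x ^ γ := by positivity
  rcases le_total x (δ ^ (-(1 / (γ - α)))) with hxM | hxM
  · have := Real.rpow_le_rpow hx hxM hα
    linarith
  · have hx0 : 0 < x := hM.trans_le hxM
    have h1 : x ^ (α - γ) ≤ δ := by
      calc x ^ (α - γ) ≤ (δ ^ (-(1 / (γ - α)))) ^ (α - γ) :=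
            Real.rpow_le_rpow_of_nonpos hM hxM (by linarith)
        _ = δ := by
            rw [← Real.rpow_mul hδ.le]
            have : -(1 / (γ - α)) * (α - γ) = 1 := by
              have : γ - α ≠ 0 := by linarith
              field_simp
              ring
            rw [this, Real.rpow_one]
    have h2 : x ^ α = x ^ (α - γ) * x ^ γ := by
      rw [← Real.rpow_add hx0]; congr 1; ring
    have h3 : x ^ (α - γ) * x ^ γ ≤ δ * x ^ γ := by gcongr
    have : 0 ≤ (δ ^ (-(1 / (γ - α)))) ^ α := by positivity
    linarith

theorem exists_rpow_le_add_mul_rpow {α γ κ : ℝ} (hα : 0 < α) (h : α < γ) (hκ : 0 < κ) :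
    ∃ C : ℝ, 0 ≤ C ∧ ∀ x : ℝ, 0 ≤ x → x ^ α ≤ κ + C * x ^ γ := by
  have hM : 0 < κ ^ (1 / α) := Real.rpow_pos_of_pos hκ _
  refine ⟨(κ ^ (1 / α)) ^ (α - γ), by positivity, fun x hx => ?_⟩
  rcases le_total x (κ ^ (1 / α)) with hxM | hxM
  · have h1 := Real.rpow_le_rpow hx hxM hα.le
    rw [← Real.rpow_mul hκ.le, one_div_mul_cancel hα.ne', Real.rpow_one] at h1
    have : 0 ≤ (κ ^ (1 / α)) ^ (α - γ) * x ^ γ := by positivity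
    linarith
  · have hx0 : 0 < x := hM.trans_le hxM
    have h1 : x ^ (α - γ) ≤ (κ ^ (1 / α)) ^ (α - γ) :=
      Real.rpow_le_rpow_of_nonpos hM hxM (by linarith)
    have h2 : x ^ α = x ^ (α - γ) * x ^ γ := by
      rw [← Real.rpow_add hx0]; congr 1; ring
    have h3 : x ^ (α - γ) * x ^ γ ≤ (κ ^ (1 / α)) ^ (α - γ) * x ^ γ := by gcongr
    linarith

theorem exists_mul_rpow_le_add_mul_rpow {α γ κ B : ℝ} (hα : 0 < α) (h : α < γ) (hκ : 0 < κ)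
    (hB : 0 ≤ B) :
    ∃ C : ℝ, 0 ≤ C ∧ ∀ x : ℝ, 0 ≤ x → B * x ^ α ≤ κ + C * x ^ γ := by
  obtain ⟨C, hC0, hC⟩ := exists_rpow_le_add_mul_rpow hα h (κ := κ / (B + 1)) (by positivity)
  refine ⟨B * C, by positivity, fun x hx => ?_⟩
  have h1 := mul_le_mul_of_nonneg_left (hC x hx) hB
  have h2 : B * (κ / (B + 1)) ≤ κ := by
    rw [← mul_div_assoc, div_le_iff₀ (by positivity)]
    nlinarith
  nlinarith

/-- Young's inequality with a small constant in front of the first factor. -/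
theorem exists_rpow_mul_le {p κ : ℝ} (hp : 1 < p) (hκ : 0 < κ) :
    ∃ C : ℝ, 0 ≤ C ∧ ∀ f x : ℝ, 0 ≤ f → 0 ≤ x →
      f ^ ((p - 1) / p) * x ≤ κ * f + C * x ^ p := by
  have hp0 : 0 < p := by linarith
  -- The constant comes from comparing x with κ f^(1/p): if x is smaller, the term κ f suffices;
  -- otherwise f^(1/p) ≤ x/κ.
  refine ⟨(1 / κ) ^ (p - 1), by positivity, fun f x hf hx => ?_⟩
  have e1 : f ^ ((p - 1) / p) = (f ^ (1 / p)) ^ (p - 1) := by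
    rw [← Real.rpow_mul hf]; congr 1; field_simp
  have e2 : f = (f ^ (1 / p)) ^ (p - 1) * f ^ (1 / p) := by
    rw [← Real.rpow_mul hf, ← Real.rpow_add_of_nonneg hf]
    · have : 1 / p * (p - 1) + 1 / p = 1 := by field_simp; ring
      rw [this, Real.rpow_one]
    · have : 0 ≤ p - 1 := by linarith
      positivity
    · positivity
  have hfp : 0 ≤ f ^ (1 / p) := by positivity
  have e3 : x ^ p = x ^ (p - 1) * x := by
    conv_lhs => rw [show p = (p - 1) + 1 by ring]
    rw [Real.rpow_add_of_nonneg hx (by linarith) (by norm_num), Real.rpow_one]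
  rw [e1, e3]
  rcases le_total x (κ * f ^ (1 / p)) with h | h
  · have : (f ^ (1 / p)) ^ (p - 1) * x ≤ (f ^ (1 / p)) ^ (p - 1) * (κ * f ^ (1 / p)) := by gcongr
    have h4 : 0 ≤ (1 / κ) ^ (p - 1) * (x ^ (p - 1) * x) := by positivity
    have : κ * f = (f ^ (1 / p)) ^ (p - 1) * (κ * f ^ (1 / p)) := by
      conv_lhs => rw [e2]
      ring
    linarith
  · have h1 : f ^ (1 / p) ≤ 1 / κ * x := by
      rw [div_mul_eq_mul_div, one_mul, le_div_iff₀ hκ]; linarith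
    have h2 : (f ^ (1 / p)) ^ (p - 1) ≤ (1 / κ * x) ^ (p - 1) :=
      Real.rpow_le_rpow hfp h1 (by linarith)
    rw [Real.mul_rpow (by positivity) hx] at h2
    have h3 := mul_le_mul_of_nonneg_right h2 hx
    have : 0 ≤ κ * f := by positivity
    linarith

/-- Young's inequality in the presence of powers of a cutoff value `η`. -/
theorem exists_mul_rpow_mul_rpow_le {α γ k l δ B : ℝ} (hα : 0 ≤ α) (h : α < γ) (hk : 0 ≤ k)
    (hkl : l * γ ≤ k * (γ - α)) (hδ : 0 < δ) (hB : 0 ≤ B) :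
    ∃ C : ℝ, 0 ≤ C ∧ ∀ y η : ℝ, 0 ≤ y → 0 ≤ η → η ≤ 1 →
      B * (y ^ α * η ^ (k - l)) ≤ δ * (y ^ γ * η ^ k) + C := by
  obtain ⟨C, hC0, hC⟩ := exists_rpow_le_mul_rpow_add hα h (δ := δ / (B + 1)) (by positivity)
  refine ⟨B * C, by positivity, fun y η hy h0 h1 => ?_⟩
  have hγ : 0 < γ := by linarith
  have hy1 : 0 ≤ η ^ (k / γ) := by positivity
  have := hC (y * η ^ (k / γ)) (by positivity)
  rw [Real.mul_rpow hy hy1, Real.mul_rpow hy hy1, ← Real.rpow_mul h0, ← Real.rpow_mul h0,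
    div_mul_cancel₀ _ hγ.ne'] at this
  have h2 : η ^ (k - l) ≤ η ^ (k / γ * α) := by
    refine Real.rpow_le_rpow_of_exponent_ge' h0 h1 (by positivity) ?_
    rw [div_mul_eq_mul_div, div_le_iff₀ hγ]
    nlinarith
  have h3 : y ^ α * η ^ (k - l) ≤ δ / (B + 1) * (y ^ γ * η ^ k) + C :=
    (mul_le_mul_of_nonneg_left h2 (by positivity)).trans this
  have h4 := mul_le_mul_of_nonneg_left h3 hB
  have h5 : B * (δ / (B + 1)) ≤ δ := by
    rw [← mul_div_assoc, div_le_iff₀ (by positivity)]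
    nlinarith
  have h6 : 0 ≤ y ^ γ * η ^ k := by positivity
  nlinarith

/-- Strong monotonicity of `a ↦ |a|^(r-2) a` for `r ≥ 2`. -/
theorem norm_sub_rpow_le_inner {E : Type*} [NormedAddCommGroup E] [InnerProductSpace ℝ E]
    {r : ℝ} (hr : 2 ≤ r) (a b : E) :
    2 ^ (1 - r) * ‖a - b‖ ^ r ≤
      inner ℝ (‖a‖ ^ (r - 2) • a - ‖b‖ ^ (r - 2) • b) (a - b) := by
  have hr2 : 0 ≤ r - 2 := by linarith
  set x := ‖a‖ ^ (r - 2) with hx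
  set y := ‖b‖ ^ (r - 2) with hy
  have hx0 : 0 ≤ x := by positivity
  have hy0 : 0 ≤ y := by positivity
  -- Symmetrised form of the inner product; its second term is non-negative because the weights are
  -- increasing functions of the norms.
  have key : inner ℝ (x • a - y • b) (a - b)
      = (x + y) / 2 * ‖a - b‖ ^ 2 + (x - y) / 2 * (‖a‖ ^ 2 - ‖b‖ ^ 2) := by
    rw [@norm_sub_sq_real E _ _ a b]
    simp only [inner_sub_left, inner_sub_right, inner_smul_left, real_inner_self_eq_norm_sq,
      RCLike.conj_to_real, real_inner_comm a b]
    ring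
  have h1 : 0 ≤ (x - y) * (‖a‖ ^ 2 - ‖b‖ ^ 2) := by
    rcases le_total ‖a‖ ‖b‖ with h | h
    · have h2 : x ≤ y := Real.rpow_le_rpow (norm_nonneg _) h hr2
      have h3 : ‖a‖ ^ 2 ≤ ‖b‖ ^ 2 := by gcongr
      exact mul_nonneg_of_nonpos_of_nonpos (by linarith) (by linarith)
    · have h2 : y ≤ x := Real.rpow_le_rpow (norm_nonneg _) h hr2
      have h3 : ‖b‖ ^ 2 ≤ ‖a‖ ^ 2 := by gcongr
      exact mul_nonneg (by linarith) (by linarith)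
  -- The larger of the two norms is at least half of ‖a - b‖.
  have h2 : ‖a - b‖ ^ (r - 2) ≤ 2 ^ (r - 2) * (x + y) := by
    rcases le_total ‖a‖ ‖b‖ with h | h
    · have h3 : ‖a - b‖ ≤ 2 * ‖b‖ := (norm_sub_le a b).trans (by linarith)
      have h4 := Real.rpow_le_rpow (norm_nonneg _) h3 hr2
      rw [Real.mul_rpow (by norm_num) (norm_nonneg _)] at h4
      exact h4.trans (by gcongr; linarith)
    · have h3 : ‖a - b‖ ≤ 2 * ‖a‖ := (norm_sub_le a b).trans (by linarith)
      have h4 := Real.rpow_le_rpow (norm_nonneg _) h3 hr2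
      rw [Real.mul_rpow (by norm_num) (norm_nonneg _)] at h4
      exact h4.trans (by gcongr; linarith)
  have h3 : ‖a - b‖ ^ r = ‖a - b‖ ^ (r - 2) * ‖a - b‖ ^ 2 := by
    rw [← Real.rpow_natCast, ← Real.rpow_add_of_nonneg (norm_nonneg _) hr2 (by norm_num)]
    congr 1
    push_cast
    ring
  have h4 : (2 : ℝ) ^ (1 - r) * 2 ^ (r - 2) = 1 / 2 := by
    rw [← Real.rpow_add (by norm_num), show 1 - r + (r - 2) = -1 by ring, Real.rpow_neg_one]
    norm_num
  rw [key, h3]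
  have h5 : (2 : ℝ) ^ (1 - r) * (‖a - b‖ ^ (r - 2) * ‖a - b‖ ^ 2)
      ≤ 2 ^ (1 - r) * (2 ^ (r - 2) * (x + y) * ‖a - b‖ ^ 2) := by gcongr
  have h6 : (2 : ℝ) ^ (1 - r) * (2 ^ (r - 2) * (x + y) * ‖a - b‖ ^ 2)
      = (x + y) / 2 * ‖a - b‖ ^ 2 := by
    calc _ = (2 : ℝ) ^ (1 - r) * 2 ^ (r - 2) * ((x + y) * ‖a - b‖ ^ 2) := by ring
      _ = _ := by rw [h4]; ring
  linarith

/-- For `1 < p ≤ 2` the vector field of the `p`-Laplacian is strongly monotone in terms of its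
own increments. -/
theorem norm_pLaplace_flux_sub_rpow_le {E : Type*} [NormedAddCommGroup E] [InnerProductSpace ℝ E]
    {p : ℝ} (hp : 1 < p) (hp2 : p ≤ 2) (ξ η : E) :
    2 ^ (1 - p / (p - 1)) * ‖‖ξ‖ ^ (p - 2) • ξ - ‖η‖ ^ (p - 2) • η‖ ^ (p / (p - 1)) ≤
      inner ℝ (‖ξ‖ ^ (p - 2) • ξ - ‖η‖ ^ (p - 2) • η) (ξ - η) := by
  have hp1 : 0 < p - 1 := by linarith
  -- The flux map for p is inverted by the flux map for the dual exponent p/(p-1) ≥ 2, so strong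
  -- monotonicity of the inverse, applied to the two fluxes, is the claim.
  have inv : ∀ ξ : E, ‖‖ξ‖ ^ (p - 2) • ξ‖ ^ (p / (p - 1) - 2) • (‖ξ‖ ^ (p - 2) • ξ) = ξ := by
    intro ξ
    rcases eq_or_ne ξ 0 with rfl | h
    · simp
    have hn : 0 < ‖ξ‖ := norm_pos_iff.mpr h
    have h1 : ‖‖ξ‖ ^ (p - 2) • ξ‖ = ‖ξ‖ ^ (p - 1) := by
      rw [norm_smul, Real.norm_of_nonneg (by positivity)]
      conv_lhs => rw [← Real.rpow_one ‖ξ‖]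
      rw [Real.rpow_one, ← Real.rpow_add_one hn.ne']
      congr 1; ring
    rw [h1, ← Real.rpow_mul hn.le, smul_smul, ← Real.rpow_add hn]
    have : (p - 1) * (p / (p - 1) - 2) + (p - 2) = 0 := by field_simp; ring
    rw [this, Real.rpow_zero, one_smul]
  have hr : 2 ≤ p / (p - 1) := by rw [le_div_iff₀ hp1]; linarith
  have := norm_sub_rpow_le_inner hr (‖ξ‖ ^ (p - 2) • ξ) (‖η‖ ^ (p - 2) • η)
  rw [inv, inv] at this
  rwa [real_inner_comm]

/-- One-dimensional strong monotonicity with exponent q + 1, divided by u - v. -/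
theorem abs_rpow_mul_sub_ge {q u v : ℝ} (hq : 1 < q) (huv : v ≤ u) :
    2 ^ (-q) * (u - v) ^ q ≤ |u| ^ (q - 1) * u - |v| ^ (q - 1) * v := by
  rcases huv.eq_or_lt with rfl | h
  · simp [Real.zero_rpow (by linarith : q ≠ 0)]
  have hd : 0 < u - v := by linarith
  have := norm_sub_rpow_le_inner (r := q + 1) (by linarith) u v
  simp only [Real.norm_eq_abs, smul_eq_mul, real_inner_eq_re_inner] at this
  rw [show q + 1 - 2 = q - 1 by ring, show 1 - (q + 1) = -q by ring, abs_of_pos hd,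
    Real.rpow_add_one hd.ne'] at this
  have h2 : RCLike.re (inner ℝ (|u| ^ (q - 1) * u - |v| ^ (q - 1) * v) (u - v))
      = (|u| ^ (q - 1) * u - |v| ^ (q - 1) * v) * (u - v) := by
    simp [mul_comm]
  rw [h2, ← mul_assoc] at this
  exact le_of_mul_le_mul_right this hd

/-! ### Pointwise absorption at unit scale -/

/-- Young's inequality with exponents p/(p-1) and p, after factoring (W^(-s-1) F η^k)^((p-1)/p) out
of the left side; the powers on the right are what remains. The case t = -s serves the weighted test
function, t = 0 the unweighted one. -/
theorem exists_flux_mul_le {p κ B : ℝ} (hp : 1 < p) (hκ : 0 < κ) (hB : 0 ≤ B) :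
    ∃ C : ℝ, 0 ≤ C ∧ ∀ s t k W F η : ℝ, p ≤ k → 0 < W → 0 ≤ F → 0 ≤ η →
      B * F ^ ((p - 1) / p) * η ^ (k - 1) * W ^ t ≤
        κ * (W ^ (-s - 1) * F * η ^ k) + C * (W ^ (t * p + (s + 1) * (p - 1)) * η ^ (k - p)) := by
  have hp0 : 0 < p := by linarith
  have hp1 : 0 < p - 1 := by linarith
  obtain ⟨C, hC0, hC⟩ := exists_rpow_mul_le hp hκ
  refine ⟨C * B ^ p, by positivity, fun s t k W F η hk hW hF hη => ?_⟩
  have h := hC (W ^ (-s - 1) * F * η ^ k)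
    (B * W ^ (t + (s + 1) * (p - 1) / p) * η ^ ((k - p) / p)) (by positivity) (by positivity)
  have hkp : 0 ≤ k - p := by linarith
  have hk0 : 0 ≤ k := by linarith
  have e1 : (W ^ (-s - 1) * F * η ^ k) ^ ((p - 1) / p) *
      (B * W ^ (t + (s + 1) * (p - 1) / p) * η ^ ((k - p) / p))
      = B * F ^ ((p - 1) / p) * η ^ (k - 1) * W ^ t := by
    rw [Real.mul_rpow (by positivity) (by positivity), Real.mul_rpow (by positivity) hF,
      ← Real.rpow_mul hW.le, ← Real.rpow_mul hη]
    have a1 : η ^ (k - 1) = η ^ (k * ((p - 1) / p)) * η ^ ((k - p) / p) := by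
      rw [← Real.rpow_add_of_nonneg hη (by positivity) (by positivity)]
      congr 1; field_simp; ring
    have a2 : W ^ t = W ^ ((-s - 1) * ((p - 1) / p)) * W ^ (t + (s + 1) * (p - 1) / p) := by
      rw [← Real.rpow_add hW]
      congr 1; field_simp; ring
    rw [a1, a2]; ring
  have e2 : (B * W ^ (t + (s + 1) * (p - 1) / p) * η ^ ((k - p) / p)) ^ p
      = B ^ p * (W ^ (t * p + (s + 1) * (p - 1)) * η ^ (k - p)) := by
    rw [Real.mul_rpow (by positivity) (by positivity), Real.mul_rpow hB (by positivity),
      ← Real.rpow_mul hW.le, ← Real.rpow_mul hη, div_mul_cancel₀ _ hp0.ne', add_mul,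
      div_mul_cancel₀ _ hp0.ne']
    ring
  rw [e1, e2] at h
  linarith

/-- Allows the source term, which controls w^q, to absorb powers of the shifted quantity w + l. For
w ≥ l one has w ≥ (w + l)/2; for w ≤ l ≤ 1 the left side is non-positive. -/
theorem rpow_mul_rpow_shift_ge {q s l w : ℝ} (hs : 0 ≤ s) (hsq : s ≤ q)
    (hl : 0 < l) (hl1 : l ≤ 1) (hw : 0 ≤ w) :
    2 ^ (-q) * (w + l) ^ (q - s) - 1 ≤ w ^ q * (w + l) ^ (-s) := by
  have hW : 0 < w + l := by linarith
  rcases le_total l w with h | h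
  · have h1 : ((w + l) / 2) ^ q ≤ w ^ q := Real.rpow_le_rpow (by positivity) (by linarith)
        (hs.trans hsq)
    rw [Real.div_rpow hW.le (by norm_num)] at h1
    have h2 : (w + l) ^ (q - s) = (w + l) ^ q * (w + l) ^ (-s) := by
      rw [← Real.rpow_add hW]; congr 1
    rw [h2, Real.rpow_neg (by norm_num)]
    have := mul_le_mul_of_nonneg_right h1 (by positivity : 0 ≤ (w + l) ^ (-s))
    have e : (2 ^ q)⁻¹ * ((w + l) ^ q * (w + l) ^ (-s)) = (w + l) ^ q / 2 ^ q * (w + l) ^ (-s) := by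
      ring
    linarith
  · have h1 : (w + l) ^ (q - s) ≤ 2 ^ (q - s) :=
      Real.rpow_le_rpow hW.le (by linarith) (by linarith)
    have h2 : (2 : ℝ) ^ (-q) * 2 ^ (q - s) ≤ 1 := by
      rw [← Real.rpow_add (by norm_num)]
      exact Real.rpow_le_one_of_one_le_of_nonpos (by norm_num) (by linarith)
    have h3 : (2 : ℝ) ^ (-q) * (w + l) ^ (q - s) ≤ 2 ^ (-q) * 2 ^ (q - s) := by gcongr
    have : 0 ≤ w ^ q * (w + l) ^ (-s) := by positivity
    linarith

/-- Pointwise absorption when testing with `(w + l)^(-s) η^k`, at unit scale. -/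
theorem exists_weighted_absorption {p q s k B c : ℝ} (hp : 1 < p) (hp2 : p ≤ 2)
    (hs : 0 < s) (hsp : s < p - 1) (hsq : s < q - 1) (hk : p ≤ k)
    (hk1 : q - s ≤ k * (q - 1)) (hk2 : p * (q - s) ≤ k * (q - p + 1)) (hB : 0 ≤ B) (hc : 0 < c) :
    ∃ C : ℝ, 0 ≤ C ∧ ∀ l w F η τ a G : ℝ, 0 < l → l ≤ 1 → 0 ≤ w → 0 ≤ F → 0 ≤ η → η ≤ 1 →
      -τ ≤ B * η ^ (k - 1) → a ≤ B * F ^ ((p - 1) / p) * η ^ (k - 1) → c * w ^ q ≤ G →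
      -((w + l) ^ (1 - s) / (1 - s) * τ) - s * ((w + l) ^ (-s - 1) * F * η ^ k)
          + (w + l) ^ (-s) * a - G * (w + l) ^ (-s) * η ^ k ≤
        -(s / 2 * ((w + l) ^ (-s - 1) * F * η ^ k)) + C := by
  have hs1 : 0 < 1 - s := by linarith
  have hk0 : 0 ≤ k := by linarith
  -- The source term supplies c 2^(-q) W^(q-s) η^k; one half absorbs the time error, the other the
  -- flux error.
  set δ := c * 2 ^ (-q) / 2 with hδ
  have hδ0 : 0 < δ := by positivity
  obtain ⟨C1, hC10, hC1⟩ := exists_mul_rpow_mul_rpow_le (α := 1 - s) (γ := q - s) (k := k) (l := 1)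
    (δ := δ) (B := B / (1 - s)) hs1.le (by linarith) hk0 (by linarith) hδ0 (by positivity)
  obtain ⟨C2, hC20, hC2⟩ := exists_flux_mul_le (κ := s / 2) hp (by positivity) hB
  obtain ⟨C3, hC30, hC3⟩ := exists_mul_rpow_mul_rpow_le (α := p - 1 - s) (γ := q - s) (k := k)
    (l := p) (δ := δ) (B := C2) (by linarith) (by linarith) hk0 (by nlinarith) hδ0 hC20
  refine ⟨C1 + C3 + c, by positivity, fun l w F η τ a G hl hl1 hw hF hη hη1 hτ ha hG => ?_⟩
  have hW : 0 < w + l := by linarith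
  set W := w + l with hWd
  have t1 : -(W ^ (1 - s) / (1 - s) * τ) ≤ δ * (W ^ (q - s) * η ^ k) + C1 := by
    have h1 := hC1 W η hW.le hη hη1
    have h2 : W ^ (1 - s) / (1 - s) * (-τ) ≤ W ^ (1 - s) / (1 - s) * (B * η ^ (k - 1)) := by gcongr
    calc _ = W ^ (1 - s) / (1 - s) * (-τ) := by ring
      _ ≤ _ := h2
      _ = B / (1 - s) * (W ^ (1 - s) * η ^ (k - 1)) := by ring
      _ ≤ _ := h1
  -- With t = -s the exponent left by `exists_flux_mul_le` is p - 1 - s, which lies between 0 and q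
  -- - s.
  have t2 : W ^ (-s) * a ≤ s / 2 * (W ^ (-s - 1) * F * η ^ k) + (δ * (W ^ (q - s) * η ^ k) + C3) := by
    have h1 := hC2 s (-s) k W F η hk hW hF hη
    have h2 := hC3 W η hW.le hη hη1
    rw [show -s * p + (s + 1) * (p - 1) = p - 1 - s by ring] at h1
    have h3 : W ^ (-s) * a ≤ W ^ (-s) * (B * F ^ ((p - 1) / p) * η ^ (k - 1)) := by gcongr
    linarith
  have t3 : c * 2 ^ (-q) * (W ^ (q - s) * η ^ k) - c ≤ G * W ^ (-s) * η ^ k := by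
    have h1 := rpow_mul_rpow_shift_ge (q := q) (s := s) hs.le (by linarith) hl hl1 hw
    rw [← hWd] at h1
    have h2 : c * w ^ q * W ^ (-s) * η ^ k ≤ G * W ^ (-s) * η ^ k := by gcongr
    have h3 : η ^ k ≤ 1 := Real.rpow_le_one hη hη1 hk0
    have h4 : 0 ≤ η ^ k := by positivity
    have h5 := mul_le_mul_of_nonneg_left (mul_le_mul_of_nonneg_right h1 h4) hc.le
    nlinarith
  have e : c * 2 ^ (-q) = δ + δ := by rw [hδ]; ring
  rw [e] at t3
  linarith

/-- Pointwise absorption when testing with `η^k`, at unit scale. -/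
theorem exists_unweighted_absorption {p q s k B c : ℝ} (hp : 1 < p) (hq : 1 < q)
    (hs : 0 < s) (hsq : (s + 1) * (p - 1) < q) (hk : p ≤ k)
    (hk1 : q ≤ k * (q - 1)) (hk2 : p * q ≤ k * (q - (s + 1) * (p - 1))) (hB : 0 ≤ B) (hc : 0 < c) :
    ∃ C : ℝ, 0 ≤ C ∧ ∀ l w F η τ a G : ℝ, 0 < l → l ≤ 1 → 0 ≤ w → 0 ≤ F → 0 ≤ η → η ≤ 1 →
      -τ ≤ B * η ^ (k - 1) → a ≤ B * F ^ ((p - 1) / p) * η ^ (k - 1) → c * w ^ q ≤ G →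
      -(w * τ) + a - G * η ^ k ≤
        -(c / 2 * (w ^ q * η ^ k)) + (w + l) ^ (-s - 1) * F * η ^ k + C := by
  have hk0 : 0 ≤ k := by linarith
  have hq0 : 0 < q := by linarith
  have hm : 0 ≤ (s + 1) * (p - 1) := mul_nonneg (by linarith) (by linarith)
  obtain ⟨C1, hC10, hC1⟩ := exists_mul_rpow_mul_rpow_le (α := 1) (γ := q) (k := k) (l := 1)
    (δ := c / 4) (B := B) (by norm_num) (by linarith) hk0 (by linarith) (by positivity) hB
  obtain ⟨C2, hC20, hC2⟩ := exists_flux_mul_le (κ := 1) hp one_pos hB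
  obtain ⟨C3, hC30, hC3⟩ := exists_mul_rpow_mul_rpow_le (α := (s + 1) * (p - 1)) (γ := q) (k := k)
    (l := p) (δ := c / 4 * 2 ^ (-q)) (B := C2) hm hsq hk0 hk2 (by positivity) hC20
  refine ⟨C1 + C3 + c / 4, by positivity, fun l w F η τ a G hl hl1 hw hF hη hη1 hτ ha hG => ?_⟩
  have hW : 0 < w + l := by linarith
  have h4 : 0 ≤ η ^ k := by positivity
  have h5 : η ^ k ≤ 1 := Real.rpow_le_one hη hη1 hk0
  have t1 : -(w * τ) ≤ c / 4 * (w ^ q * η ^ k) + C1 := by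
    have h1 := hC1 w η hw hη hη1
    rw [Real.rpow_one] at h1
    have h2 : w * (-τ) ≤ w * (B * η ^ (k - 1)) := by gcongr
    linarith
  -- Without a weight (t = 0) the remaining exponent is (s + 1)(p - 1) < q. The dissipation term
  -- cannot be absorbed here and stays on the right, to be estimated by the weighted test.
  have t2 : a ≤ (w + l) ^ (-s - 1) * F * η ^ k + (c / 4 * (w ^ q * η ^ k) + c / 4 + C3) := by
    have h1 := hC2 s 0 k (w + l) F η hk hW hF hη
    have h2 := hC3 (w + l) η hW.le hη hη1
    rw [zero_mul, zero_add, Real.rpow_zero, mul_one, one_mul] at h1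
    have h3 := rpow_mul_rpow_shift_ge (q := q) (s := 0) le_rfl hq0.le hl hl1 hw
    rw [neg_zero, Real.rpow_zero, mul_one, sub_zero] at h3
    have h6 : c / 4 * (2 ^ (-q) * (w + l) ^ q * η ^ k) ≤ c / 4 * ((w ^ q + 1) * η ^ k) := by
      gcongr; linarith
    nlinarith
  have t3 : c * w ^ q * η ^ k ≤ G * η ^ k := by gcongr
  linarith

/-- Pointwise bound when testing with `η^k`, keeping track of the set `χ = 1` where the cutoff is
not constant, at unit scale. -/
theorem exists_annular_absorption {p q s k B c κ : ℝ} (hp : 1 < p) (hq : 1 < q)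
    (hs : 0 < s) (hsq : (s + 1) * (p - 1) < q) (hk : p ≤ k) (hB : 0 ≤ B) (hκ : 0 < κ) :
    ∃ l : ℝ, 0 < l ∧ l ≤ 1 ∧ ∃ C : ℝ, 0 ≤ C ∧ ∀ w F η τ a G χ : ℝ, 0 ≤ w → 0 ≤ F → 0 ≤ η → η ≤ 1 →
      (χ = 0 ∨ χ = 1) → -τ ≤ B * η ^ (k - 1) * χ → a ≤ B * F ^ ((p - 1) / p) * η ^ (k - 1) * χ →
      c * w ^ q ≤ G →
      -(w * τ) + a - G * η ^ k ≤
        -(c * (w ^ q * η ^ k)) + κ * ((w + l) ^ (-s - 1) * F * η ^ k) + κ + C * (w ^ q * χ) := by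
  have hk0 : 0 ≤ k := by linarith
  have hq0 : 0 < q := by linarith
  set m := (s + 1) * (p - 1) with hmd
  have hm : 0 < m := mul_pos (by linarith) (by linarith)
  obtain ⟨C1, hC10, hC1⟩ := exists_mul_rpow_le_add_mul_rpow (α := 1) (γ := q) (κ := κ / 2) (B := B)
    (by norm_num) (by linarith) (by positivity) hB
  obtain ⟨C2, hC20, hC2⟩ := exists_flux_mul_le (κ := κ) hp hκ hB
  obtain ⟨C3, hC30, hC3⟩ := exists_mul_rpow_le_add_mul_rpow (α := m) (γ := q) (κ := κ / 4)
    (B := C2 * 2 ^ m) hm hsq (by positivity) (by positivity)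
  -- The shift l leaves a constant C2 2^m l^m in the flux error even where w = 0; it is made small
  -- by the choice of l, and C2 does not depend on l.
  obtain ⟨l, hl0, hl1, hl⟩ : ∃ l : ℝ, 0 < l ∧ l ≤ 1 ∧ C2 * 2 ^ m * l ^ m ≤ κ / 4 := by
    obtain ⟨D, hD0, hD⟩ := exists_mul_rpow_le_add_mul_rpow (α := m) (γ := m + 1) (κ := κ / 8)
      (B := C2 * 2 ^ m) hm (by linarith) (by positivity) (by positivity)
    refine ⟨min 1 (κ / 8 / (D + 1)), by positivity, min_le_left _ _, ?_⟩
    set l := min 1 (κ / 8 / (D + 1)) with hld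
    have hl0 : 0 < l := by positivity
    have h1 := hD l hl0.le
    have h2 : l ^ (m + 1) ≤ l := by
      conv_rhs => rw [← Real.rpow_one l]
      exact Real.rpow_le_rpow_of_exponent_ge hl0 (min_le_left _ _) (by linarith)
    have h3 : (D + 1) * l ≤ κ / 8 := by
      have := min_le_right 1 (κ / 8 / (D + 1))
      rw [le_div_iff₀ (by positivity)] at this
      linarith
    nlinarith
  refine ⟨l, hl0, hl1, C1 + C3, by positivity, ?_⟩
  intro w F η τ a G χ hw hF hη hη1 hχ hτ ha hG
  have hW : 0 < w + l := by linarith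
  have h4 : 0 ≤ η ^ k := by positivity
  have h6 : 0 ≤ η ^ (k - 1) := by positivity
  have h5 : η ^ (k - 1) ≤ 1 := Real.rpow_le_one hη hη1 (by linarith)
  have h7 : η ^ (k - p) ≤ 1 := Real.rpow_le_one hη hη1 (by linarith)
  have t3 : c * w ^ q * η ^ k ≤ G * η ^ k := by gcongr
  rcases hχ with rfl | rfl
  -- Where χ = 0, both -τ and a are non-positive and can be dropped.
  · have h1 : 0 ≤ κ * ((w + l) ^ (-s - 1) * F * η ^ k) := by positivity
    have h2 : w * (-τ) ≤ w * 0 := by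
      refine mul_le_mul_of_nonneg_left ?_ hw
      linarith
    have h3 : a ≤ 0 := by linarith
    linarith
  · have t1 : -(w * τ) ≤ κ / 2 + C1 * w ^ q := by
      have h1 := hC1 w hw
      rw [Real.rpow_one] at h1
      have h2 : w * (-τ) ≤ w * (B * 1) := by
        refine mul_le_mul_of_nonneg_left (hτ.trans ?_) hw
        rw [mul_one]
        gcongr
      linarith
    have t2 : a ≤ κ * ((w + l) ^ (-s - 1) * F * η ^ k) + (κ / 2 + C3 * w ^ q) := by
      have h1 := hC2 s 0 k (w + l) F η hk hW hF hη
      rw [zero_mul, zero_add, Real.rpow_zero, mul_one, ← hmd] at h1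
      have h2 : C2 * ((w + l) ^ m * η ^ (k - p)) ≤ C2 * ((w + l) ^ m * 1) := by gcongr
      have h3 : (w + l) ^ m ≤ 2 ^ m * (w ^ m + l ^ m) := by
        rcases le_total w l with h | h
        · calc (w + l) ^ m ≤ (2 * l) ^ m := Real.rpow_le_rpow hW.le (by linarith) hm.le
            _ = 2 ^ m * l ^ m := Real.mul_rpow (by norm_num) hl0.le
            _ ≤ _ := by gcongr; linarith [Real.rpow_nonneg hw m]
        · calc (w + l) ^ m ≤ (2 * w) ^ m := Real.rpow_le_rpow hW.le (by linarith) hm.le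
            _ = 2 ^ m * w ^ m := Real.mul_rpow (by norm_num) hw
            _ ≤ _ := by gcongr; linarith [Real.rpow_nonneg hl0.le m]
      have h8 := hC3 w hw
      have h9 := mul_le_mul_of_nonneg_left h3 hC20
      nlinarith
    linarith

/-! ### Mollification -/

section Mollification

open Filter Topology ContinuousLinearMap

/-- A sequence of bump functions concentrating at the origin. -/
noncomputable def shrinkingBump (E : Type*) [NormedAddCommGroup E] (j : ℕ) :
    ContDiffBump (0 : E) where
  rIn := 1 / (2 * ((j : ℝ) + 1))
  rOut := 1 / ((j : ℝ) + 1)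
  rIn_pos := by positivity
  rIn_lt_rOut := by
    apply one_div_lt_one_div_of_lt <;> linarith [(Nat.cast_nonneg j : (0 : ℝ) ≤ j)]

theorem shrinkingBump_rOut_tendsto (E : Type*) [NormedAddCommGroup E] :
    Tendsto (fun j => (shrinkingBump E j).rOut) atTop (𝓝 0) :=
  tendsto_one_div_add_atTop_nhds_zero_nat

variable {E : Type*} [NormedAddCommGroup E] [NormedSpace ℝ E] [FiniteDimensional ℝ E]
  [MeasureSpace E]

/-- The convolution of `f` with a normalised bump of radius `1 / (j + 1)`. -/
noncomputable def mollify (j : ℕ) (f : E → ℝ) : E → ℝ :=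
  convolution ((shrinkingBump E j).normed volume) f (lsmul ℝ ℝ) volume

theorem mollify_apply (f : E → ℝ) (j : ℕ) (z : E) :
    mollify j f z = ∫ y, (shrinkingBump E j).normed volume y * f (z - y) := rfl

variable [BorelSpace E] [(volume : Measure E).IsAddHaarMeasure]

theorem mollify_integrand_integrable {f : E → ℝ} (hf : LocallyIntegrable f volume) (j : ℕ) (z : E) :
    Integrable (fun y => (shrinkingBump E j).normed volume y * f (z - y)) volume :=
  (shrinkingBump E j).hasCompactSupport_normed.convolutionExists_left (lsmul ℝ ℝ)
    (shrinkingBump E j).continuous_normed hf z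

theorem ae_mollify_tendsto {f : E → ℝ} (hf : LocallyIntegrable f volume) :
    ∀ᵐ z, Tendsto (fun j => mollify j f z) atTop (𝓝 (f z)) := by
  -- K = 2 is the ratio of outer to inner radius, the same for every j.
  refine ContDiffBump.ae_convolution_tendsto_right_of_locallyIntegrable (K := 2)
    (shrinkingBump_rOut_tendsto E) (Eventually.of_forall fun j => ?_) hf
  simp only [shrinkingBump]
  apply le_of_eq
  field_simp

theorem integrable_mollify {f : E → ℝ} (hf : Integrable f volume) (j : ℕ) :
    Integrable (mollify j f) volume :=
  (shrinkingBump E j).integrable_normed.integrable_convolution _ hf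

theorem integral_mollify {f : E → ℝ} (hf : Integrable f volume) (j : ℕ) :
    ∫ z, mollify j f z = ∫ z, f z := by
  unfold mollify
  rw [integral_convolution _ (shrinkingBump E j).integrable_normed hf,
    (shrinkingBump E j).integral_normed]
  simp

theorem mollify_nonneg {f : E → ℝ} (hf : ∀ᵐ z, 0 ≤ f z) (j : ℕ) (z : E) : 0 ≤ mollify j f z := by
  rw [mollify_apply]
  refine integral_nonneg_of_ae ?_
  have h := (quasiMeasurePreserving_sub_left volume z).ae hf
  filter_upwards [h] with y hy
  exact mul_nonneg ((shrinkingBump E j).nonneg_normed y) hy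

theorem contDiff_mollify {f : E → ℝ} (hf : LocallyIntegrable f volume) (j : ℕ) :
    ContDiff ℝ (⊤ : ℕ∞) (mollify j f) :=
  (shrinkingBump E j).hasCompactSupport_normed.contDiff_convolution_left _
    (shrinkingBump E j).contDiff_normed hf

/-- Scheffé's argument: mollification preserves the integral, so the L¹ distance is twice the
integral of the positive part of f - f_j, which is dominated by f. -/
theorem tendsto_integral_abs_mollify_sub {f : E → ℝ} (hf : Integrable f volume)
    (hf0 : ∀ z, 0 ≤ f z) :
    Tendsto (fun j => ∫ z, |mollify j f z - f z|) atTop (𝓝 0) := by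
  have hae := ae_mollify_tendsto hf.locallyIntegrable
  have h1 : Tendsto (fun j => ∫ z, max (f z - mollify j f z) 0) atTop (𝓝 (∫ _ : E, (0 : ℝ))) := by
    refine tendsto_integral_of_dominated_convergence f ?_ hf ?_ ?_
    · exact fun j => ((hf.sub (integrable_mollify hf j)).pos_part).aestronglyMeasurable
    · refine fun j => Eventually.of_forall fun z => ?_
      have := mollify_nonneg (Eventually.of_forall hf0) j z
      rw [Real.norm_of_nonneg (le_max_right _ _)]
      exact max_le (by linarith) (hf0 z)
    · filter_upwards [hae] with z hz
      have := (((tendsto_const_nhds (x := f z)).sub hz).max (tendsto_const_nhds (x := (0 : ℝ))))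
      simpa using this
  have h2 : ∀ j, ∫ z, |mollify j f z - f z| = 2 * ∫ z, max (f z - mollify j f z) 0 := by
    intro j
    have e : ∀ z, |mollify j f z - f z|
        = (mollify j f z - f z) + 2 * max (f z - mollify j f z) 0 := by
      intro z
      rcases le_total (f z) (mollify j f z) with h | h
      · rw [abs_of_nonneg (by linarith), max_eq_right (by linarith)]; ring
      · rw [abs_of_nonpos (by linarith), max_eq_left (by linarith)]; ring
    simp_rw [e]
    have i1 := integrable_mollify hf j
    have i2 : Integrable (fun z => mollify j f z - f z) volume := i1.sub hf
    have i3 : Integrable (fun z => 2 * max (f z - mollify j f z) 0) volume :=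
      ((hf.sub i1).pos_part).const_mul 2
    rw [integral_add i2 i3, integral_sub i1 hf,
      integral_mollify hf, sub_self, zero_add, integral_const_mul]
  simp_rw [h2]
  simpa using h1.const_mul 2

/-- Dominated convergence with mollified dominating functions. -/
theorem tendsto_integral_of_le_mollify {F : ℕ → E → ℝ} {f b h : E → ℝ} {C : ℝ}
    (hF : ∀ j, AEStronglyMeasurable (F j) volume) (hb : Integrable b volume)
    (hh : Integrable h volume) (hh0 : ∀ z, 0 ≤ h z) (hC : 0 ≤ C)
    (hle : ∀ᶠ j in atTop, ∀ᵐ z, |F j z| ≤ b z + C * mollify j h z)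
    (hlim : ∀ᵐ z, Tendsto (fun j => F j z) atTop (𝓝 (f z))) :
    Integrable f volume ∧ Tendsto (fun j => ∫ z, F j z) atTop (𝓝 (∫ z, f z)) := by
  obtain ⟨N, hN⟩ := eventually_atTop.mp hle
  have hle' : ∀ᵐ z, ∀ j, N ≤ j → |F j z| ≤ b z + C * mollify j h z := by
    rw [ae_all_iff]
    intro j
    by_cases hj : N ≤ j
    · filter_upwards [hN j hj] with z hz _ using hz
    · exact Eventually.of_forall fun z h => absurd h hj
  have hfm : AEStronglyMeasurable f volume := aestronglyMeasurable_of_tendsto_ae atTop hF hlim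
  have hD : Integrable (fun z => b z + C * h z) volume := hb.add (hh.const_mul C)
  have hfle : ∀ᵐ z, |f z| ≤ b z + C * h z := by
    filter_upwards [hle', hlim, ae_mollify_tendsto hh.locallyIntegrable] with z h1 h2 h3
    refine le_of_tendsto_of_tendsto h2.abs ((tendsto_const_nhds (x := b z)).add (h3.const_mul C)) ?_
    filter_upwards [eventually_ge_atTop N] with j hj using h1 j hj
  have hfi : Integrable f volume := hD.mono' hfm hfle
  refine ⟨hfi, ?_⟩
  have hFi : ∀ j, N ≤ j → Integrable (F j) volume := fun j hj =>
    (hb.add ((integrable_mollify hh j).const_mul C)).mono' (hF j) (hN j hj)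
  have i1 : ∀ j, Integrable (fun z => C * |mollify j h z - h z|) volume := fun j =>
    (((integrable_mollify hh j).sub hh).abs).const_mul C
  -- Since |F j| + |f| ≤ 2(b + C h) + C |h_j - h|, the function |F j - f| exceeds its truncation at
  -- the fixed integrable function 2(b + C h) by at most C |h_j - h|, which tends to 0 in L¹.
  have key : Tendsto (fun j => ∫ z, min |F j z - f z| (2 * (b z + C * h z))) atTop
      (𝓝 (∫ _ : E, (0 : ℝ))) := by
    refine tendsto_integral_of_dominated_convergence (fun z => 2 * (b z + C * h z)) ?_
      (hD.const_mul 2) ?_ ?_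
    · exact fun j => (continuous_abs.comp_aestronglyMeasurable ((hF j).sub hfm)).inf
        (hD.const_mul 2).aestronglyMeasurable
    · intro j
      filter_upwards [hfle] with z hz
      have h0 : 0 ≤ b z + C * h z := (abs_nonneg _).trans hz
      rw [Real.norm_of_nonneg (le_min (abs_nonneg _) (by linarith))]
      exact min_le_right _ _
    · filter_upwards [hlim, hfle] with z hz hz2
      have h0 : 0 ≤ b z + C * h z := (abs_nonneg _).trans hz2
      have := ((hz.sub (tendsto_const_nhds (x := f z))).abs.min
        (tendsto_const_nhds (x := 2 * (b z + C * h z))))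
      rw [sub_self, abs_zero, min_eq_left (by linarith)] at this
      exact this
  have hup : Tendsto (fun j => (∫ z, C * |mollify j h z - h z|)
      + ∫ z, min |F j z - f z| (2 * (b z + C * h z))) atTop (𝓝 0) := by
    have := ((tendsto_integral_abs_mollify_sub hh hh0).const_mul C).add key
    simp_rw [integral_const_mul]
    simpa using this
  rw [tendsto_iff_norm_sub_tendsto_zero]
  refine squeeze_zero' (Eventually.of_forall fun _ => norm_nonneg _) ?_ hup
  filter_upwards [eventually_ge_atTop N] with j hj
  rw [← integral_sub (hFi j hj) hfi]
  refine (norm_integral_le_integral_norm _).trans ?_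
  have i2 : Integrable (fun z => min |F j z - f z| (2 * (b z + C * h z))) volume :=
    ((hFi j hj).sub hfi).abs.inf (hD.const_mul 2)
  rw [← integral_add (i1 j) i2]
  refine integral_mono_ae ((hFi j hj).sub hfi).norm ((i1 j).add i2) ?_
  filter_upwards [hle', hfle] with z h1 h2
  have h3 := h1 j hj
  have h4 : |F j z - f z| ≤ |F j z| + |f z| := abs_sub _ _
  have h5 : C * (mollify j h z - h z) ≤ C * |mollify j h z - h z| := by
    gcongr; exact le_abs_self _
  have h6 : 0 ≤ C * |mollify j h z - h z| := by positivity
  change |F j z - f z| ≤ C * |mollify j h z - h z| + min |F j z - f z| (2 * (b z + C * h z))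
  rcases min_cases |F j z - f z| (2 * (b z + C * h z)) with ⟨h7, _⟩ | ⟨h7, _⟩ <;> rw [h7] <;>
    linarith

/-- A Young inequality for the product of a number with a mollified function. -/
theorem abs_mul_abs_mollify_le {p p' : ℝ} (hpp : p.HolderConjugate p') {f : E → ℝ}
    (hf : Integrable f volume) (hfp : Integrable (fun z => |f z| ^ p) volume) (a : ℝ) (j : ℕ)
    (z : E) :
    |a| * |mollify j f z| ≤ |a| ^ p' + mollify j (fun z => |f z| ^ p) z := by
  set ρ := (shrinkingBump E j).normed (volume : Measure E) with hρ
  have i1 := mollify_integrand_integrable hf.locallyIntegrable j z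
  have i2 := mollify_integrand_integrable hfp.locallyIntegrable j z
  have i3 : Integrable (fun y => ρ y * |f (z - y)|) volume := by
    refine i1.abs.congr (Eventually.of_forall fun y => ?_)
    simp only [abs_mul, abs_of_nonneg ((shrinkingBump E j).nonneg_normed y), hρ]
  have i4 : Integrable (fun y => ρ y * |a| ^ p') volume :=
    (shrinkingBump E j).integrable_normed.mul_const _
  have h1 : |mollify j f z| ≤ ∫ y, ρ y * |f (z - y)| := by
    rw [mollify_apply]
    refine abs_integral_le_integral_abs.trans (le_of_eq ?_)
    congr 1; ext y
    rw [abs_mul, abs_of_nonneg ((shrinkingBump E j).nonneg_normed y)]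
  calc |a| * |mollify j f z| ≤ |a| * ∫ y, ρ y * |f (z - y)| := by gcongr
    _ = ∫ y, |a| * (ρ y * |f (z - y)|) := (integral_const_mul _ _).symm
    _ ≤ ∫ y, (ρ y * |a| ^ p' + ρ y * |f (z - y)| ^ p) := by
        refine integral_mono (i3.const_mul _) (i4.add i2) fun y => ?_
        have h2 : |f (z - y)| * |a| ≤ |f (z - y)| ^ p + |a| ^ p' := by
          have h3 := Real.young_inequality_of_nonneg (abs_nonneg (f (z - y))) (abs_nonneg a) hpp
          have h4 : |f (z - y)| ^ p / p ≤ |f (z - y)| ^ p :=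
            div_le_self (by positivity) hpp.lt.le
          have h5 : |a| ^ p' / p' ≤ |a| ^ p' := div_le_self (by positivity) hpp.symm.lt.le
          linarith
        have h6 := mul_le_mul_of_nonneg_left h2 ((shrinkingBump E j).nonneg_normed (μ := volume) y)
        simp only [← hρ] at h6
        change |a| * (ρ y * |f (z - y)|) ≤ ρ y * |a| ^ p' + ρ y * |f (z - y)| ^ p
        linarith
    _ = _ := by
        rw [integral_add i4 i2, integral_mul_const, (shrinkingBump E j).integral_normed, one_mul]
        rfl

omit [BorelSpace E] [(volume : Measure E).IsAddHaarMeasure] in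
theorem abs_mollify_le {f : E → ℝ} (j : ℕ) (z : E) :
    |mollify j f z| ≤ mollify j (fun z => |f z|) z := by
  rw [mollify_apply]
  refine abs_integral_le_integral_abs.trans (le_of_eq ?_)
  rw [mollify_apply]
  congr 1; ext y
  rw [abs_mul, abs_of_nonneg ((shrinkingBump E j).nonneg_normed y)]

/-- Mollification commutes with weak differentiation away from the boundary. -/
theorem fderiv_mollify_indicator {Ω : Opens E} {e : E} {f g : E → ℝ}
    (h : HasWeakDirDeriv Ω e f g) {K : Set E} (hKΩ : K ⊆ Ω)
    (hfK : Integrable (K.indicator f) volume)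
    {j : ℕ} {z : E} (hz : Metric.closedBall z (shrinkingBump E j).rOut ⊆ K) :
    fderiv ℝ (mollify j (K.indicator f)) z e = mollify j (K.indicator g) z := by
  set ρ := (shrinkingBump E j).normed (volume : Measure E) with hρ
  have hρs : ContDiff ℝ (⊤ : ℕ∞) ρ := (shrinkingBump E j).contDiff_normed
  have hρc : HasCompactSupport ρ := (shrinkingBump E j).hasCompactSupport_normed
  have hρd : Differentiable ℝ ρ := hρs.differentiable (by simp)
  have h1 := (hρc.hasFDerivAt_convolution_left (lsmul ℝ ℝ) (μ := volume)
    (hρs.of_le (by exact_mod_cast le_top)) hfK.locallyIntegrable z).fderiv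
  have hpt : ∀ y, fderiv ℝ (fun y => ρ (z - y)) y = -fderiv ℝ ρ (z - y) := by
    intro y
    have := (hρd (z - y)).hasFDerivAt.comp y ((hasFDerivAt_id y).const_sub z)
    refine (HasFDerivAt.fderiv (f' := -fderiv ℝ ρ (z - y)) ?_)
    convert! this using 1
    ext v
    simp
  have hsupp : tsupport (fun y => ρ (z - y)) ⊆ Metric.closedBall z (shrinkingBump E j).rOut := by
    refine closure_minimal ?_ Metric.isClosed_closedBall
    intro y hy
    have : z - y ∈ Function.support ρ := hy
    rw [hρ, (shrinkingBump E j).support_normed_eq, mem_ball_zero_iff] at this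
    rw [Metric.mem_closedBall, dist_comm, dist_eq_norm]
    exact this.le
  have hcomp : HasCompactSupport (fun y => ρ (z - y)) :=
    HasCompactSupport.of_support_subset_isCompact (isCompact_closedBall _ _)
      (subset_closure.trans hsupp)
  -- The reflected and translated kernel is an admissible test function. It is supported in K, so
  -- cutting f and g off outside K changes nothing.
  let φ : TestFunction Ω ℝ (⊤ : ℕ∞) :=
    ⟨fun y => ρ (z - y), hρs.comp (contDiff_const.sub contDiff_id), hcomp,
      hsupp.trans (hz.trans hKΩ)⟩
  have hφ : ∀ y, (φ : E → ℝ) y = ρ (z - y) := fun y => rfl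
  have hφ0 : ∀ y, y ∉ K → φ y = 0 := by
    intro y hy
    exact image_eq_zero_of_notMem_tsupport fun h' => hy (hz (hsupp h'))
  have hφd : ∀ y, fderiv ℝ φ y = -fderiv ℝ ρ (z - y) := hpt
  have hφd0 : ∀ y, y ∉ K → fderiv ℝ φ y = 0 := by
    intro y hy
    exact image_eq_zero_of_notMem_tsupport
      fun h' => hy (hz (hsupp (tsupport_fderiv_subset ℝ h')))
  have key := h.2.2 φ
  have hΩ : MeasurableSet (Ω : Set E) := Ω.isOpen.measurableSet
  have e1 : ∫ y in Ω, f y * fderiv ℝ φ y e = ∫ y, K.indicator f y * fderiv ℝ φ y e := by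
    rw [← integral_indicator hΩ]
    congr 1; ext y
    by_cases hy : y ∈ K
    · rw [Set.indicator_of_mem (hKΩ hy), Set.indicator_of_mem hy]
    · rw [Set.indicator_of_notMem hy, zero_mul]
      by_cases hy' : y ∈ (Ω : Set E)
      · rw [Set.indicator_of_mem hy', hφd0 y hy]; simp
      · rw [Set.indicator_of_notMem hy']
  have e2 : ∫ y in Ω, g y * φ y = ∫ y, K.indicator g y * φ y := by
    rw [← integral_indicator hΩ]
    congr 1; ext y
    by_cases hy : y ∈ K
    · rw [Set.indicator_of_mem (hKΩ hy), Set.indicator_of_mem hy]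
    · rw [Set.indicator_of_notMem hy, zero_mul]
      by_cases hy' : y ∈ (Ω : Set E)
      · rw [Set.indicator_of_mem hy', hφ0 y hy]; simp
      · rw [Set.indicator_of_notMem hy']
  rw [e1, e2] at key
  have e3 : fderiv ℝ (mollify j (K.indicator f)) z e
      = ∫ y, fderiv ℝ ρ y e * K.indicator f (z - y) := by
    have hex : Integrable (fun t => (lsmul ℝ ℝ : ℝ →L[ℝ] ℝ →L[ℝ] ℝ).precompL E
        (fderiv ℝ ρ t) (K.indicator f (z - t))) volume :=
      (hρc.fderiv ℝ).convolutionExists_left _ (hρs.continuous_fderiv (by simp))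
        hfK.locallyIntegrable z
    unfold mollify
    rw [h1]
    simp only [convolution]
    rw [ContinuousLinearMap.integral_apply hex]
    simp
  have e4 : ∫ y, fderiv ℝ ρ y e * K.indicator f (z - y)
      = ∫ y, fderiv ℝ ρ (z - y) e * K.indicator f y := by
    rw [← integral_sub_left_eq_self _ volume z]
    simp
  have e5 : mollify j (K.indicator g) z = ∫ y, ρ (z - y) * K.indicator g y := by
    rw [mollify_apply, ← integral_sub_left_eq_self _ volume z]
    simp [hρ]
  rw [e3, e4, e5]
  have e6 : ∫ y, K.indicator f y * fderiv ℝ φ y e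
      = -∫ y, fderiv ℝ ρ (z - y) e * K.indicator f y := by
    rw [← integral_neg]
    congr 1; ext y
    rw [hφd]; simp [mul_comm]
  rw [e6, neg_inj] at key
  rw [key]
  congr 1; ext y
  rw [hφ, mul_comm]

end Mollification

/-! ### Nonlinear test functions and the chain rule -/

section ChainRuleTest

open Filter Topology

variable {E : Type*} [NormedAddCommGroup E] [NormedSpace ℝ E]

theorem TestFunction.exists_abs_le {Ω : Opens E} (ζ : TestFunction Ω ℝ (⊤ : ℕ∞)) :
    ∃ Z : ℝ, 0 ≤ Z ∧ ∀ z, |ζ z| ≤ Z := by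
  obtain ⟨Z, hZ⟩ := ζ.continuous.bounded_above_of_compact_support ζ.hasCompactSupport
  exact ⟨Z, (norm_nonneg _).trans (hZ 0), hZ⟩

theorem TestFunction.continuous_fderiv_apply {Ω : Opens E} (ζ : TestFunction Ω ℝ (⊤ : ℕ∞)) (e : E) :
    Continuous fun z => fderiv ℝ ζ z e :=
  (ζ.contDiff.continuous_fderiv (by simp)).clm_apply continuous_const

theorem TestFunction.exists_abs_fderiv_apply_le {Ω : Opens E} (ζ : TestFunction Ω ℝ (⊤ : ℕ∞))
    (e : E) : ∃ Z : ℝ, 0 ≤ Z ∧ ∀ z, |fderiv ℝ ζ z e| ≤ Z := by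
  obtain ⟨Z, hZ⟩ := (ζ.contDiff.continuous_fderiv (by simp)).bounded_above_of_compact_support
    (ζ.hasCompactSupport.fderiv ℝ)
  have hZ0 : 0 ≤ Z := (norm_nonneg _).trans (hZ 0)
  refine ⟨Z * ‖e‖, by positivity, fun z => ?_⟩
  exact ((fderiv ℝ ζ z).le_opNorm e).trans (by gcongr; exact hZ z)

theorem TestFunction.eq_zero_of_notMem {Ω : Opens E} (ζ : TestFunction Ω ℝ (⊤ : ℕ∞)) {z : E}
    (hz : z ∉ tsupport ζ) : ζ z = 0 ∧ fderiv ℝ ζ z = 0 :=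
  ⟨image_eq_zero_of_notMem_tsupport hz,
    image_eq_zero_of_notMem_tsupport fun h => hz (tsupport_fderiv_subset ℝ h)⟩

theorem abs_le_add_mul_of_hasDerivAt {H g : ℝ → ℝ} {M : ℝ} (hH : ∀ r, 0 ≤ r → HasDerivAt H (g r) r)
    (hg0 : ∀ r, 0 ≤ r → 0 ≤ g r) (hgM : ∀ r, 0 ≤ r → g r ≤ M) {r : ℝ} (hr : 0 ≤ r) :
    |H r| ≤ |H 0| + M * r := by
  have h := (convex_Ici (0 : ℝ)).norm_image_sub_le_of_norm_hasDerivWithin_le (f := H) (f' := g)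
    (C := M) (x := 0) (y := r) (fun x hx => (hH x hx).hasDerivWithinAt)
    (fun x hx => by rw [Real.norm_of_nonneg (hg0 x hx)]; exact hgM x hx) (Set.self_mem_Ici) hr
  rw [sub_zero, Real.norm_eq_abs, Real.norm_of_nonneg hr] at h
  have := abs_sub_abs_le_abs_sub (H r) (H 0)
  linarith

variable [FiniteDimensional ℝ E] [MeasureSpace E] [BorelSpace E]
  [(volume : Measure E).IsAddHaarMeasure]

theorem mollify_finsetSum {ι : Type*} (s : Finset ι) {f : ι → E → ℝ}
    (hf : ∀ i ∈ s, LocallyIntegrable (f i) volume) (j : ℕ) (z : E) :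
    mollify j (fun z => ∑ i ∈ s, f i z) z = ∑ i ∈ s, mollify j (f i) z := by
  simp_rw [mollify_apply, Finset.mul_sum]
  exact integral_finsetSum s fun i hi => mollify_integrand_integrable (hf i hi) j z

/-- Chain rule `∂(H ∘ w) = g(w) ∂w`, `g = H'`, for mollifications and, in the limit, for a
non-negative weakly differentiable function. -/
theorem integral_weakDeriv_mul_comp {Ω : Opens E} {τ : E} {w wt : E → ℝ}
    (hwt : HasWeakDirDeriv Ω τ w wt) {K : Set E} (hKΩ : K ⊆ Ω)
    (hw : Integrable (K.indicator w) volume) (hwti : Integrable (K.indicator wt) volume)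
    (hw0 : ∀ᵐ z, 0 ≤ K.indicator w z)
    {g H : ℝ → ℝ} {M : ℝ} (hH : ∀ r, 0 ≤ r → HasDerivAt H (g r) r)
    (hgc : ∀ r, 0 ≤ r → ContinuousAt g r) (hg0 : ∀ r, 0 ≤ r → 0 ≤ g r)
    (hgM : ∀ r, 0 ≤ r → g r ≤ M)
    (ζ : TestFunction Ω ℝ (⊤ : ℕ∞)) {δ : ℝ} (hδ : 0 < δ)
    (hδK : Metric.cthickening δ (tsupport ζ) ⊆ K) :
    Integrable (fun z => K.indicator wt z * g (K.indicator w z) * ζ z) volume ∧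
    Integrable (fun z => H (K.indicator w z) * fderiv ℝ ζ z τ) volume ∧
    ∫ z, K.indicator wt z * g (K.indicator w z) * ζ z
      = -∫ z, H (K.indicator w z) * fderiv ℝ ζ z τ := by
  have hM : 0 ≤ M := (hg0 0 le_rfl).trans (hgM 0 le_rfl)
  obtain ⟨Z, hZ0, hZ⟩ := ζ.exists_abs_le
  obtain ⟨Y, hY0, hY⟩ := ζ.exists_abs_fderiv_apply_le τ
  set wK := K.indicator w with hwK
  set wtK := K.indicator wt with hwtK
  -- g and H are controlled only on [0, ∞); mollification turns a.e. non-negativity of w into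
  -- non-negativity at every point.
  have hj0 : ∀ j z, 0 ≤ mollify j wK z := mollify_nonneg hw0
  have hjs : ∀ j, ContDiff ℝ (⊤ : ℕ∞) (mollify j wK) := contDiff_mollify hw.locallyIntegrable
  have hgcj : ∀ j, Continuous fun z => g (mollify j wK z) := fun j =>
    continuous_iff_continuousAt.mpr fun z =>
      (hgc _ (hj0 j z)).comp (f := mollify j wK) (hjs j).continuous.continuousAt
  have hHd : ∀ j z, HasFDerivAt (fun z => H (mollify j wK z))
      (g (mollify j wK z) • fderiv ℝ (mollify j wK) z) z := fun j z =>
    (hH _ (hj0 j z)).comp_hasFDerivAt z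
      ((hjs j).differentiable (by simp) z).hasFDerivAt
  have hHcj : ∀ j, Continuous fun z => H (mollify j wK z) := fun j =>
    continuous_iff_continuousAt.mpr fun z => (hHd j z).continuousAt
  have hae := ae_mollify_tendsto hw.locallyIntegrable
  have haet := ae_mollify_tendsto hwti.locallyIntegrable
  obtain ⟨I1, L1⟩ := tendsto_integral_of_le_mollify (C := M * Z) (b := fun _ => 0)
    (h := fun z => |wtK z|)
    (F := fun j z => mollify j wtK z * g (mollify j wK z) * ζ z)
    (f := fun z => wtK z * g (wK z) * ζ z)
    (fun j => ((contDiff_mollify hwti.locallyIntegrable j).continuous.mul (hgcj j)).mul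
      ζ.continuous |>.aestronglyMeasurable)
    (integrable_zero _ _ _) hwti.abs (fun z => abs_nonneg _) (by positivity)
    (Eventually.of_forall fun j => Eventually.of_forall fun z => by
      rw [abs_mul, abs_mul, abs_of_nonneg (hg0 _ (hj0 j z)), zero_add]
      have h1 := abs_mollify_le (f := wtK) j z
      have h2 := hgM _ (hj0 j z)
      have h3 := hg0 _ (hj0 j z)
      calc _ ≤ mollify j (fun z => |wtK z|) z * M * Z := by
            have h4 := (abs_nonneg _).trans h1
            gcongr
            exact hZ z
        _ = _ := by ring)
    (by
      filter_upwards [hae, haet, hw0] with z h1 h2 h3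
      exact (h2.mul ((hgc _ h3).tendsto.comp h1)).mul_const _)
  obtain ⟨I2, L2⟩ := tendsto_integral_of_le_mollify (C := M * Y)
    (b := fun z => |H 0| * |fderiv ℝ ζ z τ|) (h := fun z => |wK z|)
    (F := fun j z => H (mollify j wK z) * fderiv ℝ ζ z τ)
    (f := fun z => H (wK z) * fderiv ℝ ζ z τ)
    (fun j => ((hHcj j).mul (ζ.continuous_fderiv_apply τ)).aestronglyMeasurable)
    (((ζ.continuous_fderiv_apply τ).integrable_of_hasCompactSupport
      (ζ.hasCompactSupport.fderiv_apply ℝ τ)).abs.const_mul _)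
    hw.abs (fun z => abs_nonneg _) (by positivity)
    (Eventually.of_forall fun j => Eventually.of_forall fun z => by
      rw [abs_mul]
      have h1 := abs_le_add_mul_of_hasDerivAt hH hg0 hgM (hj0 j z)
      have h2 : mollify j wK z ≤ mollify j (fun z => |wK z|) z :=
        (le_abs_self _).trans (abs_mollify_le j z)
      have h4 : 0 ≤ mollify j (fun z => |wK z|) z := (hj0 j z).trans h2
      calc |H (mollify j wK z)| * |fderiv ℝ ζ z τ|
          ≤ (|H 0| + M * mollify j (fun z => |wK z|) z) * |fderiv ℝ ζ z τ| := by
            gcongr; exact h1.trans (by gcongr)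
        _ = |H 0| * |fderiv ℝ ζ z τ| + M * mollify j (fun z => |wK z|) z * |fderiv ℝ ζ z τ| := by
            ring
        _ ≤ |H 0| * |fderiv ℝ ζ z τ| + M * mollify j (fun z => |wK z|) z * Y := by
            gcongr; exact hY z
        _ = _ := by ring)
    (by
      filter_upwards [hae, hw0] with z h1 h3
      exact ((hH _ h3).continuousAt.tendsto.comp h1).mul_const _)
  refine ⟨I1, I2, ?_⟩
  -- Once the mollification radius is below δ, the derivative of the mollified w on the support of ζ
  -- is the mollified weak derivative, and the identity is classical integration by parts for a
  -- smooth function.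
  refine tendsto_nhds_unique L1 (L2.neg.congr' ?_)
  filter_upwards [(shrinkingBump_rOut_tendsto E).eventually (gt_mem_nhds hδ)] with j hj
  have hder : ∀ z, ζ z * fderiv ℝ (mollify j wK) z τ = ζ z * mollify j wtK z := by
    intro z
    by_cases hz : z ∈ tsupport ζ
    · rw [fderiv_mollify_indicator hwt hKΩ hw]
      exact ((Metric.closedBall_subset_closedBall hj.le).trans
        (Metric.closedBall_subset_cthickening hz δ)).trans hδK
    · rw [(ζ.eq_zero_of_notMem hz).1]; simp
  have hfd : ∀ z, fderiv ℝ (fun z => H (mollify j wK z)) z τ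
      = g (mollify j wK z) * fderiv ℝ (mollify j wK) z τ := fun z => by
    rw [(hHd j z).fderiv]; simp
  have hcont : Continuous fun z => fderiv ℝ (fun z => H (mollify j wK z)) z τ := by
    simp_rw [hfd]
    exact (hgcj j).mul (((hjs j).continuous_fderiv (by simp)).clm_apply continuous_const)
  have ibp := integral_mul_fderiv_eq_neg_fderiv_mul_of_integrable (μ := (volume : Measure E))
    (f := fun z => H (mollify j wK z)) (g := ζ) (v := τ)
    ((hcont.mul ζ.continuous).integrable_of_hasCompactSupport ζ.hasCompactSupport.mul_left)
    (((hHcj j).mul (ζ.continuous_fderiv_apply τ)).integrable_of_hasCompactSupport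
      (ζ.hasCompactSupport.fderiv_apply ℝ τ).mul_left)
    (((hHcj j).mul ζ.continuous).integrable_of_hasCompactSupport ζ.hasCompactSupport.mul_left)
    (fun z _ => (hHd j z).differentiableAt) (fun z _ => ζ.contDiff.differentiable (by simp) z)
  rw [ibp, neg_neg]
  congr 1; ext z
  rw [hfd, mul_assoc, mul_comm _ (ζ z), hder]
  ring

/-- Testing a differential inequality for `w ≥ 0` with `g(w) ζ`. -/
theorem integral_comp_test_nonneg {ι : Type*} [Fintype ι] {p p' : ℝ} (hpp : p.HolderConjugate p')
    {Ω : Opens E} {τ : E} {e : ι → E} {w wt G : E → ℝ} {D A : ι → E → ℝ}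
    (hwt : HasWeakDirDeriv Ω τ w wt) (hD : ∀ i, HasWeakDirDeriv Ω (e i) w (D i))
    (hDp : ∀ i, LocallyIntegrableOn (fun z => |D i z| ^ p) Ω)
    (hA : ∀ i, LocallyIntegrableOn (A i) Ω)
    (hAp : ∀ i, LocallyIntegrableOn (fun z => |A i z| ^ p') Ω)
    (hG : LocallyIntegrableOn G Ω)
    (hw0 : ∀ᵐ z ∂volume.restrict (Ω : Set E), 0 ≤ w z)
    (hsup : ∀ φ : TestFunction Ω ℝ (⊤ : ℕ∞), (∀ z, 0 ≤ φ z) →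
      0 ≤ ∫ z in Ω, (wt z * φ z + ∑ i, A i z * fderiv ℝ φ z (e i) - G z * φ z))
    {g g' H : ℝ → ℝ} {M : ℝ} (hH : ∀ r, 0 ≤ r → HasDerivAt H (g r) r)
    (hg : ∀ r, 0 ≤ r → HasDerivAt g (g' r) r) (hgs : ∀ r, 0 ≤ r → ContDiffAt ℝ (⊤ : ℕ∞) g r)
    (hg'c : ∀ r, 0 ≤ r → ContinuousAt g' r) (hg0 : ∀ r, 0 ≤ r → 0 ≤ g r)
    (hgM : ∀ r, 0 ≤ r → g r ≤ M) (hg'M : ∀ r, 0 ≤ r → |g' r| ≤ M)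
    (ζ : TestFunction Ω ℝ (⊤ : ℕ∞)) (hζ : ∀ z, 0 ≤ ζ z) :
    IntegrableOn (fun z => -(H (w z) * fderiv ℝ ζ z τ)
      + ∑ i, A i z * (g' (w z) * D i z * ζ z + g (w z) * fderiv ℝ ζ z (e i))
      - G z * g (w z) * ζ z) Ω ∧
    0 ≤ ∫ z in Ω, (-(H (w z) * fderiv ℝ ζ z τ)
      + ∑ i, A i z * (g' (w z) * D i z * ζ z + g (w z) * fderiv ℝ ζ z (e i))
      - G z * g (w z) * ζ z) := by
  have hM : 0 ≤ M := (hg0 0 le_rfl).trans (hgM 0 le_rfl)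
  have hgc : ∀ r, 0 ≤ r → ContinuousAt g r := fun r hr => (hg r hr).continuousAt
  have hΩm : MeasurableSet (Ω : Set E) := Ω.isOpen.measurableSet
  -- K contains a δ-neighbourhood of the support of ζ and is compact in Ω: local integrability
  -- becomes integrability on K, and mollification at small radius near the support sees only K.
  obtain ⟨δ, hδ, K, hKc, hKΩ, hδK⟩ : ∃ δ : ℝ, 0 < δ ∧ ∃ K : Set E, IsCompact K ∧ K ⊆ Ω ∧
      Metric.cthickening δ (tsupport ζ) ⊆ K := by
    obtain ⟨δ₁, h1, h1'⟩ := ζ.hasCompactSupport.isCompact.exists_isCompact_cthickening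
    obtain ⟨δ₂, h2, h2'⟩ := ζ.hasCompactSupport.isCompact.exists_cthickening_subset_open
      Ω.isOpen ζ.tsupport_subset
    refine ⟨min δ₁ δ₂, lt_min h1 h2, _, h1'.of_isClosed_subset Metric.isClosed_cthickening
      (Metric.cthickening_mono (min_le_left _ _) _), ?_, subset_rfl⟩
    exact (Metric.cthickening_mono (min_le_right _ _) _).trans h2'
  have hKm : MeasurableSet K := hKc.measurableSet
  have hζK : tsupport ζ ⊆ K := (Metric.self_subset_cthickening _).trans hδK
  have hint : ∀ {f : E → ℝ}, LocallyIntegrableOn f Ω → Integrable (K.indicator f) volume :=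
    fun hf => (integrable_indicator_iff hKm).mpr (hf.integrableOn_compact_subset hKΩ hKc)
  have hwi := hint hwt.1
  have hwti := hint hwt.2.1
  have hGi := hint hG
  have hDi := fun i => hint (hD i).2.1
  have hAi := fun i => hint (hA i)
  have hp0 : p ≠ 0 := hpp.ne_zero
  have hp'0 : p' ≠ 0 := hpp.symm.ne_zero
  have hDpi : ∀ i, Integrable (fun z => |K.indicator (D i) z| ^ p) volume := fun i => by
    refine (hint (hDp i)).congr (Eventually.of_forall fun z => ?_)
    by_cases hz : z ∈ K <;> simp [hz, Real.zero_rpow hp0]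
  have hApi : ∀ i, Integrable (fun z => |K.indicator (A i) z| ^ p') volume := fun i => by
    refine (hint (hAp i)).congr (Eventually.of_forall fun z => ?_)
    by_cases hz : z ∈ K <;> simp [hz, Real.zero_rpow hp'0]
  have hw0K : ∀ᵐ z, 0 ≤ K.indicator w z := by
    rw [ae_restrict_iff' hΩm] at hw0
    filter_upwards [hw0] with z hz
    by_cases hzK : z ∈ K
    · rw [Set.indicator_of_mem hzK]; exact hz (hKΩ hzK)
    · rw [Set.indicator_of_notMem hzK]
  obtain ⟨I1, I2, E12⟩ := integral_weakDeriv_mul_comp hwt hKΩ hwi hwti hw0K hH hgc hg0 hgM ζ hδ hδK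
  obtain ⟨Z, hZ0, hZ⟩ := ζ.exists_abs_le
  choose Y hY0 hY using fun i => ζ.exists_abs_fderiv_apply_le (e i)
  set wK := K.indicator w with hwK
  set wtK := K.indicator wt with hwtK
  set GK := K.indicator G with hGK
  set DK := fun i => K.indicator (D i) with hDK
  set AK := fun i => K.indicator (A i) with hAK
  have hj0 : ∀ j z, 0 ≤ mollify j wK z := mollify_nonneg hw0K
  have hjs : ∀ j, ContDiff ℝ (⊤ : ℕ∞) (mollify j wK) := contDiff_mollify hwi.locallyIntegrable
  have hgcj : ∀ j, Continuous fun z => g (mollify j wK z) := fun j =>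
    continuous_iff_continuousAt.mpr fun z =>
      (hgc _ (hj0 j z)).comp (f := mollify j wK) (hjs j).continuous.continuousAt
  have hg'cj : ∀ j, Continuous fun z => g' (mollify j wK z) := fun j =>
    continuous_iff_continuousAt.mpr fun z =>
      (hg'c _ (hj0 j z)).comp (f := mollify j wK) (hjs j).continuous.continuousAt
  have hae := ae_mollify_tendsto hwi.locallyIntegrable
  have haeD : ∀ᵐ z, ∀ i, Tendsto (fun j => mollify j (DK i) z) atTop (𝓝 (DK i z)) :=
    ae_all_iff.mpr fun i => ae_mollify_tendsto (hDi i).locallyIntegrable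
  -- Only w inside the test function is mollified. The delicate product is A_i times the mollified
  -- D_i, which has no fixed dominating function; Young's inequality bounds it by |A_i|^p' plus the
  -- mollification of |D_i|^p.
  obtain ⟨I3, L3⟩ := tendsto_integral_of_le_mollify (C := M * Z)
    (b := fun z => M * Z * |wtK z| + ∑ i, (M * Z * |AK i z| ^ p' + M * Y i * |AK i z|)
      + M * Z * |GK z|) (h := fun z => ∑ i, |DK i z| ^ p)
    (F := fun j z => wtK z * g (mollify j wK z) * ζ z
      + ∑ i, AK i z * (g' (mollify j wK z) * mollify j (DK i) z * ζ z
        + g (mollify j wK z) * fderiv ℝ ζ z (e i)) - GK z * g (mollify j wK z) * ζ z)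
    (f := fun z => wtK z * g (wK z) * ζ z
      + ∑ i, AK i z * (g' (wK z) * DK i z * ζ z
        + g (wK z) * fderiv ℝ ζ z (e i)) - GK z * g (wK z) * ζ z)
    (fun j => by
      refine ((((hwti.aestronglyMeasurable.mul (hgcj j).aestronglyMeasurable).mul
        ζ.continuous.aestronglyMeasurable)).add ?_).sub
        ((hGi.aestronglyMeasurable.mul (hgcj j).aestronglyMeasurable).mul
        ζ.continuous.aestronglyMeasurable)
      refine Finset.aestronglyMeasurable_fun_sum _ fun i _ => ?_
      refine (hAi i).aestronglyMeasurable.mul (Continuous.aestronglyMeasurable ?_)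
      exact (((hg'cj j).mul (contDiff_mollify (hDi i).locallyIntegrable j).continuous).mul
        ζ.continuous).add ((hgcj j).mul (ζ.continuous_fderiv_apply _)))
    (((hwti.abs.const_mul _).add (integrable_finsetSum _ fun i _ =>
      ((hApi i).const_mul _).add ((hAi i).abs.const_mul _))).add (hGi.abs.const_mul _))
    (integrable_finsetSum _ fun i _ => hDpi i)
    (fun z => Finset.sum_nonneg fun i _ => by positivity) (by positivity)
    (Eventually.of_forall fun j => Eventually.of_forall fun z => by
      have hgz := hgM _ (hj0 j z)
      have hgz0 := hg0 _ (hj0 j z)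
      have hg'z := hg'M _ (hj0 j z)
      have hZz := hZ z
      have t1 : ∀ x : ℝ, |x * g (mollify j wK z) * ζ z| ≤ M * Z * |x| := by
        intro x
        rw [abs_mul, abs_mul, abs_of_nonneg hgz0]
        calc _ ≤ |x| * M * Z := by gcongr
          _ = _ := by ring
      have t2 : ∀ i, |AK i z * (g' (mollify j wK z) * mollify j (DK i) z * ζ z
          + g (mollify j wK z) * fderiv ℝ ζ z (e i))|
          ≤ (M * Z * |AK i z| ^ p' + M * Y i * |AK i z|)
            + M * Z * mollify j (fun z => |DK i z| ^ p) z := by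
        intro i
        have h1 := abs_mul_abs_mollify_le hpp (hDi i) (hDpi i) (AK i z) j z
        have h2 : |AK i z * (g' (mollify j wK z) * mollify j (DK i) z * ζ z)|
            ≤ M * Z * (|AK i z| * |mollify j (DK i) z|) := by
          rw [abs_mul, abs_mul, abs_mul]
          calc _ ≤ |AK i z| * (M * |mollify j (DK i) z| * Z) := by gcongr
            _ = _ := by ring
        have h3 : |AK i z * (g (mollify j wK z) * fderiv ℝ ζ z (e i))|
            ≤ M * Y i * |AK i z| := by
          rw [abs_mul, abs_mul, abs_of_nonneg hgz0]
          calc _ ≤ |AK i z| * (M * Y i) := by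
                gcongr
                exact hY i z
            _ = _ := by ring
        have h4 := mul_le_mul_of_nonneg_left h1 (mul_nonneg hM hZ0)
        rw [mul_add]
        refine (abs_add_le _ _).trans ?_
        linarith
      rw [mollify_finsetSum _ fun i _ => (hDpi i).locallyIntegrable, Finset.mul_sum]
      refine (abs_sub _ _).trans ?_
      have t3 := abs_add_le (wtK z * g (mollify j wK z) * ζ z)
        (∑ i, AK i z * (g' (mollify j wK z) * mollify j (DK i) z * ζ z
          + g (mollify j wK z) * fderiv ℝ ζ z (e i)))
      have t4 := (Finset.abs_sum_le_sum_abs (fun i => AK i z * (g' (mollify j wK z)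
        * mollify j (DK i) z * ζ z + g (mollify j wK z) * fderiv ℝ ζ z (e i))) Finset.univ).trans
        (Finset.sum_le_sum fun i _ => t2 i)
      rw [Finset.sum_add_distrib] at t4
      have t5 := t1 (wtK z)
      have t6 := t1 (GK z)
      linarith)
    (by
      filter_upwards [hae, haeD, hw0K] with z h1 h2 h3
      have hg1 := (hgc _ h3).tendsto.comp h1
      have hg2 := (hg'c _ h3).tendsto.comp h1
      refine (((hg1.const_mul _).mul_const _).add ?_).sub ((hg1.const_mul _).mul_const _)
      refine tendsto_finsetSum _ fun i _ => ?_
      exact (((hg2.mul (h2 i)).mul_const _).add (hg1.mul_const _)).const_mul _)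
  have hlim0 : 0 ≤ ∫ z, (wtK z * g (wK z) * ζ z
      + ∑ i, AK i z * (g' (wK z) * DK i z * ζ z
        + g (wK z) * fderiv ℝ ζ z (e i)) - GK z * g (wK z) * ζ z) := by
    refine ge_of_tendsto L3 ?_
    filter_upwards [(shrinkingBump_rOut_tendsto E).eventually (gt_mem_nhds hδ)] with j hj
    let φ : TestFunction Ω ℝ (⊤ : ℕ∞) :=
      ⟨fun z => g (mollify j wK z) * ζ z,
        (contDiff_iff_contDiffAt.mpr fun z =>
          (hgs _ (hj0 j z)).comp (f := mollify j wK) z (hjs j).contDiffAt).mul ζ.contDiff,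
        ζ.hasCompactSupport.mul_left,
        (tsupport_mul_subset_right).trans ζ.tsupport_subset⟩
    have hφ : ∀ z, φ z = g (mollify j wK z) * ζ z := fun z => rfl
    have hφd : ∀ z v, fderiv ℝ φ z v = g' (mollify j wK z) * fderiv ℝ (mollify j wK) z v * ζ z
        + g (mollify j wK z) * fderiv ℝ ζ z v := by
      intro z v
      have h1 : HasFDerivAt (fun z => g (mollify j wK z))
          (g' (mollify j wK z) • fderiv ℝ (mollify j wK) z) z :=
        (hg _ (hj0 j z)).comp_hasFDerivAt z ((hjs j).differentiable (by simp) z).hasFDerivAt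
      have h2 := h1.mul (ζ.contDiff.differentiable (by simp) z).hasFDerivAt
      have h3 : fderiv ℝ φ z = _ := h2.fderiv
      rw [h3]
      simp
      ring
    refine (hsup φ fun z => mul_nonneg (hg0 _ (hj0 j z)) (hζ z)).trans_eq ?_
    rw [← integral_indicator hΩm]
    congr 1; ext z
    by_cases hz : z ∈ tsupport ζ
    · have hzK := hζK hz
      rw [Set.indicator_of_mem (hKΩ hzK)]
      have hd : ∀ i, fderiv ℝ (mollify j wK) z (e i) = mollify j (DK i) z := fun i =>
        fderiv_mollify_indicator (hD i) hKΩ hwi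
          (((Metric.closedBall_subset_closedBall hj.le).trans
            (Metric.closedBall_subset_cthickening hz δ)).trans hδK)
      simp only [hwtK, hGK, hAK, Set.indicator_of_mem hzK, hφ, hφd, hd, ← mul_assoc]
    · obtain ⟨hz1, hz2⟩ := ζ.eq_zero_of_notMem hz
      by_cases hzΩ : z ∈ (Ω : Set E)
      · rw [Set.indicator_of_mem hzΩ]
        simp [hφ, hφd, hz1, hz2]
      · rw [Set.indicator_of_notMem hzΩ]
        simp [hz1, hz2]
  have hI : Integrable (fun z => -(H (wK z) * fderiv ℝ ζ z τ)
      + ∑ i, AK i z * (g' (wK z) * DK i z * ζ z + g (wK z) * fderiv ℝ ζ z (e i))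
      - GK z * g (wK z) * ζ z) volume := by
    refine ((I3.sub I1).add I2.neg).congr (Eventually.of_forall fun z => ?_)
    simp only [Pi.add_apply, Pi.sub_apply, Pi.neg_apply]
    ring
  -- The limit still contains the weak time derivative; the chain rule trades it for -H(w) times the
  -- time derivative of ζ.
  have hV : ∫ z, (-(H (wK z) * fderiv ℝ ζ z τ)
      + ∑ i, AK i z * (g' (wK z) * DK i z * ζ z + g (wK z) * fderiv ℝ ζ z (e i))
      - GK z * g (wK z) * ζ z) = ∫ z, (wtK z * g (wK z) * ζ z
      + ∑ i, AK i z * (g' (wK z) * DK i z * ζ z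
        + g (wK z) * fderiv ℝ ζ z (e i)) - GK z * g (wK z) * ζ z) := by
    rw [← sub_eq_zero, ← integral_sub hI I3]
    have : ∀ z, (-(H (wK z) * fderiv ℝ ζ z τ)
      + ∑ i, AK i z * (g' (wK z) * DK i z * ζ z + g (wK z) * fderiv ℝ ζ z (e i))
      - GK z * g (wK z) * ζ z) - (wtK z * g (wK z) * ζ z
      + ∑ i, AK i z * (g' (wK z) * DK i z * ζ z
        + g (wK z) * fderiv ℝ ζ z (e i)) - GK z * g (wK z) * ζ z)
        = -(H (wK z) * fderiv ℝ ζ z τ) - wtK z * g (wK z) * ζ z := fun z => by ring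
    simp_rw [this]
    have I4 : Integrable (fun z => -(H (wK z) * fderiv ℝ ζ z τ)) volume := I2.neg
    rw [integral_sub I4 I1, integral_neg, E12, sub_self]
  have hEq : (Ω : Set E).indicator (fun z => -(H (w z) * fderiv ℝ ζ z τ)
      + ∑ i, A i z * (g' (w z) * D i z * ζ z + g (w z) * fderiv ℝ ζ z (e i))
      - G z * g (w z) * ζ z) = fun z => -(H (wK z) * fderiv ℝ ζ z τ)
      + ∑ i, AK i z * (g' (wK z) * DK i z * ζ z + g (wK z) * fderiv ℝ ζ z (e i))
      - GK z * g (wK z) * ζ z := by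
    ext z
    by_cases hz : z ∈ tsupport ζ
    · have hzK := hζK hz
      rw [Set.indicator_of_mem (hKΩ hzK)]
      simp only [hwK, hGK, hAK, hDK, Set.indicator_of_mem hzK]
    · obtain ⟨hz1, hz2⟩ := ζ.eq_zero_of_notMem hz
      by_cases hzΩ : z ∈ (Ω : Set E)
      · rw [Set.indicator_of_mem hzΩ]
        simp [hz1, hz2]
      · rw [Set.indicator_of_notMem hzΩ]
        simp [hz1, hz2]
  constructor
  · rw [← integrable_indicator_iff hΩm, hEq]
    exact hI
  · rw [← integral_indicator hΩm, hEq, hV]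
    exact hlim0

end ChainRuleTest

/-! ### Cutoff functions -/

theorem exists_bound_deriv_smoothTransition :
    ∃ B : ℝ, 0 ≤ B ∧ ∀ x, |deriv Real.smoothTransition x| ≤ B := by
  have hc : Continuous (deriv Real.smoothTransition) :=
    (Real.smoothTransition.contDiff (n := 1)).continuous_deriv le_rfl
  have h0 : ∀ x, x ∉ Set.Icc (0 : ℝ) 1 → deriv Real.smoothTransition x = 0 := by
    intro x hx
    rw [Set.mem_Icc, not_and_or, not_le, not_le] at hx
    rcases hx with hx | hx
    · have : Real.smoothTransition =ᶠ[nhds x] fun _ => 0 := by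
        filter_upwards [gt_mem_nhds hx] with y hy using Real.smoothTransition.zero_of_nonpos hy.le
      rw [this.deriv_eq, deriv_const]
    · have : Real.smoothTransition =ᶠ[nhds x] fun _ => 1 := by
        filter_upwards [lt_mem_nhds hx] with y hy using Real.smoothTransition.one_of_one_le hy.le
      rw [this.deriv_eq, deriv_const]
  obtain ⟨B, hB⟩ := hc.bounded_above_of_compact_support
    (HasCompactSupport.intro isCompact_Icc h0)
  exact ⟨B, (norm_nonneg _).trans (hB 0), hB⟩

theorem Real.smoothTransition.hasDerivAt (x : ℝ) :
    HasDerivAt Real.smoothTransition (deriv Real.smoothTransition x) x :=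
  ((Real.smoothTransition.contDiff (n := 1)).differentiable (by simp) x).hasDerivAt

theorem Real.smoothTransition.deriv_eq_zero_of_one_lt {x : ℝ} (hx : 1 < x) :
    deriv Real.smoothTransition x = 0 := by
  have : Real.smoothTransition =ᶠ[nhds x] fun _ => 1 := by
    filter_upwards [lt_mem_nhds hx] with y hy using Real.smoothTransition.one_of_one_le hy.le
  rw [this.deriv_eq, deriv_const]

theorem Real.smoothTransition.deriv_eq_zero_of_neg {x : ℝ} (hx : x < 0) :
    deriv Real.smoothTransition x = 0 := by
  have : Real.smoothTransition =ᶠ[nhds x] fun _ => 0 := by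
    filter_upwards [gt_mem_nhds hx] with y hy using Real.smoothTransition.zero_of_nonpos hy.le
  rw [this.deriv_eq, deriv_const]

/-- The part of space-time where a cutoff at time `T` and radius `R` may decrease. -/
def farRegion (n : ℕ) (T R : ℝ) : Set (SpaceTime n) := {z | T ≤ z.1 ∨ R ≤ ‖z.2‖}

/-- Cutoff functions in space-time whose time derivative is bounded below by `-B / T` and whose
spatial gradient is bounded by `B / R`, both only on the far region. -/
theorem exists_cutoff (n : ℕ) : ∃ B : ℝ, 0 ≤ B ∧ ∀ T R τ : ℝ, 0 < T → 0 < R → 0 < τ →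
    ∃ η : SpaceTime n → ℝ, ContDiff ℝ (⊤ : ℕ∞) η ∧ (∀ z, 0 ≤ η z) ∧ (∀ z, η z ≤ 1) ∧
      (∀ z, η z ≠ 0 → τ ≤ z.1 ∧ z.1 ≤ 2 * T ∧ ‖z.2‖ ≤ 2 * R) ∧
      (∀ z, 2 * τ ≤ z.1 → z.1 ≤ T → ‖z.2‖ ≤ R → η z = 1) ∧
      (∀ z, -fderiv ℝ η z (1, 0) ≤ B * T⁻¹ * (farRegion n T R).indicator 1 z) ∧
      (∀ z ξ, fderiv ℝ η z (0, ξ) ≤ B * R⁻¹ * ‖ξ‖ * (farRegion n T R).indicator 1 z) := by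
  obtain ⟨B, hB0, hB⟩ := exists_bound_deriv_smoothTransition
  -- The gradient of |x|²/R² has norm 2|x|/R², at most 4/R for |x| ≤ 2R; hence the factor 4.
  refine ⟨4 * B, by positivity, fun T R τ hT hR hτ => ?_⟩
  set f := Real.smoothTransition with hf
  have hf0 : ∀ x, 0 ≤ f x := Real.smoothTransition.nonneg
  have hf1 : ∀ x, f x ≤ 1 := Real.smoothTransition.le_one
  -- The first factor rises on [τ, 2τ], the second falls on [T, 2T]. Below, b uses the squared norm
  -- so as to be smooth at the origin.
  set a : ℝ → ℝ := fun t => f (t / τ - 1) * f (2 - t / T) with ha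
  set b : EuclideanSpace ℝ (Fin n) → ℝ := fun x => f (2 - ‖x‖ ^ 2 / R ^ 2) with hb
  have ha0 : ∀ t, 0 ≤ a t := fun t => mul_nonneg (hf0 _) (hf0 _)
  have ha1 : ∀ t, a t ≤ 1 := fun t => mul_le_one₀ (hf1 _) (hf0 _) (hf1 _)
  have hac : ContDiff ℝ (⊤ : ℕ∞) a := by
    refine ContDiff.mul (Real.smoothTransition.contDiff.comp ?_)
      (Real.smoothTransition.contDiff.comp ?_) <;> fun_prop
  have hbc : ContDiff ℝ (⊤ : ℕ∞) b := by
    refine Real.smoothTransition.contDiff.comp ?_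
    exact contDiff_const.sub ((contDiff_norm_sq ℝ).div_const _)
  have had : ∀ t, HasDerivAt a (deriv f (t / τ - 1) * τ⁻¹ * f (2 - t / T)
      + f (t / τ - 1) * (deriv f (2 - t / T) * (-T⁻¹))) t := by
    intro t
    have h1 : HasDerivAt (fun t : ℝ => t / τ - 1) τ⁻¹ t := by
      simpa [one_div] using ((hasDerivAt_id t).div_const τ).sub_const 1
    have h2 : HasDerivAt (fun t : ℝ => 2 - t / T) (-T⁻¹) t := by
      simpa [one_div] using ((hasDerivAt_id t).div_const T).const_sub 2
    exact ((Real.smoothTransition.hasDerivAt _).comp t h1).mul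
      ((Real.smoothTransition.hasDerivAt _).comp t h2)
  have hbd : ∀ x, HasFDerivAt b (deriv f (2 - ‖x‖ ^ 2 / R ^ 2) •
      -((R ^ 2)⁻¹ • ((2 : ℝ) • innerSL ℝ x))) x := by
    intro x
    have h1 : HasFDerivAt (fun x : EuclideanSpace ℝ (Fin n) => 2 - ‖x‖ ^ 2 / R ^ 2)
        (-((R ^ 2)⁻¹ • ((2 : ℝ) • innerSL ℝ x))) x := by
      have h2 := (((hasStrictFDerivAt_norm_sq x).hasFDerivAt).const_mul (R ^ 2)⁻¹).const_sub 2
      convert! h2 using 1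
      · ext y
        rw [div_eq_inv_mul]
      · ext y
        simp
    exact (Real.smoothTransition.hasDerivAt _).comp_hasFDerivAt x h1
  have hηd : ∀ z : SpaceTime n, HasFDerivAt (fun z : SpaceTime n => a z.1 * b z.2)
      (a z.1 • (fderiv ℝ b z.2).comp (ContinuousLinearMap.snd ℝ ℝ (EuclideanSpace ℝ (Fin n)))
        + b z.2 • (deriv a z.1 • ContinuousLinearMap.fst ℝ ℝ (EuclideanSpace ℝ (Fin n)))) z := by
    intro z
    have h1 : HasFDerivAt (fun z : SpaceTime n => a z.1)
        (deriv a z.1 • ContinuousLinearMap.fst ℝ ℝ (EuclideanSpace ℝ (Fin n))) z :=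
      (had z.1).differentiableAt.hasDerivAt.comp_hasFDerivAt z hasFDerivAt_fst
    have h2 : HasFDerivAt (fun z : SpaceTime n => b z.2)
        ((fderiv ℝ b z.2).comp (ContinuousLinearMap.snd ℝ ℝ (EuclideanSpace ℝ (Fin n)))) z :=
      (hbd z.2).differentiableAt.hasFDerivAt.comp z hasFDerivAt_snd
    exact h1.mul h2
  refine ⟨fun z => a z.1 * b z.2, (hac.comp contDiff_fst).mul (hbc.comp contDiff_snd),
    fun z => mul_nonneg (ha0 _) (hf0 _), fun z => mul_le_one₀ (ha1 _) (hf0 _) (hf1 _), ?_, ?_, ?_, ?_⟩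
  · intro z hz
    refine ⟨?_, ?_, ?_⟩
    · by_contra! h
      apply hz
      have : f (z.1 / τ - 1) = 0 := by
        apply Real.smoothTransition.zero_of_nonpos
        rw [sub_nonpos, div_le_one hτ]; exact h.le
      simp [ha, this]
    · by_contra! h
      apply hz
      have : f (2 - z.1 / T) = 0 := by
        apply Real.smoothTransition.zero_of_nonpos
        rw [sub_nonpos, le_div_iff₀ hT]; exact h.le
      simp [ha, this]
    · by_contra! h
      apply hz
      have : f (2 - ‖z.2‖ ^ 2 / R ^ 2) = 0 := by
        apply Real.smoothTransition.zero_of_nonpos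
        rw [sub_nonpos, le_div_iff₀ (by positivity)]
        nlinarith
      simp [hb, this]
  · intro z h1 h2 h3
    have e1 : f (z.1 / τ - 1) = 1 := by
      apply Real.smoothTransition.one_of_one_le
      rw [le_sub_iff_add_le, le_div_iff₀ hτ]; linarith
    have e2 : f (2 - z.1 / T) = 1 := by
      apply Real.smoothTransition.one_of_one_le
      have : z.1 / T ≤ 1 := by rwa [div_le_one hT]
      linarith
    have e3 : f (2 - ‖z.2‖ ^ 2 / R ^ 2) = 1 := by
      apply Real.smoothTransition.one_of_one_le
      have : ‖z.2‖ ^ 2 / R ^ 2 ≤ 1 := by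
        rw [div_le_one (by positivity)]; gcongr
      linarith
    simp [ha, hb, e1, e2, e3]
  · intro z
    rw [(hηd z).fderiv]
    simp only [_root_.add_apply, _root_.smul_apply,
      ContinuousLinearMap.comp_apply, ContinuousLinearMap.coe_snd', ContinuousLinearMap.coe_fst',
      map_zero, smul_eq_mul, mul_one]
    rw [(had z.1).deriv]
    -- The rise at small times makes the time derivative larger, so it is dropped from the upper
    -- bound for its negative; this is why the constant does not depend on τ.
    have h1 : 0 ≤ deriv f (z.1 / τ - 1) := Real.smoothTransition.monotone.deriv_nonneg
    have h2 : 0 ≤ deriv f (z.1 / τ - 1) * τ⁻¹ * f (2 - z.1 / T) :=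
      mul_nonneg (mul_nonneg h1 (by positivity)) (hf0 _)
    have hb0 : 0 ≤ b z.2 := hf0 _
    have hb1 : b z.2 ≤ 1 := hf1 _
    have h3 : deriv f (2 - z.1 / T) ≤ B * (farRegion n T R).indicator 1 z := by
      by_cases hz : z ∈ farRegion n T R
      · rw [Set.indicator_of_mem hz]; simpa using (le_abs_self _).trans (hB _)
      · rw [Set.indicator_of_notMem hz, mul_zero]
        simp only [farRegion, Set.mem_ofPred_eq, not_or, not_le] at hz
        refine (Real.smoothTransition.deriv_eq_zero_of_one_lt ?_).le
        have : z.1 / T < 1 := by rw [div_lt_one hT]; exact hz.1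
        linarith
    have h4 : 0 ≤ B * (farRegion n T R).indicator 1 z :=
      mul_nonneg hB0 (Set.indicator_nonneg (fun _ _ => zero_le_one) _)
    have h5 : f (z.1 / τ - 1) * deriv f (2 - z.1 / T) ≤ B * (farRegion n T R).indicator 1 z := by
      calc _ ≤ f (z.1 / τ - 1) * (B * (farRegion n T R).indicator 1 z) := by
            gcongr; exact hf0 _
        _ ≤ 1 * (B * (farRegion n T R).indicator 1 z) := by gcongr; exact hf1 _
        _ = _ := one_mul _
    have hTi : 0 < T⁻¹ := by positivity
    calc _ ≤ b z.2 * (T⁻¹ * (f (z.1 / τ - 1) * deriv f (2 - z.1 / T))) := by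
          have := mul_nonneg hb0 h2
          linarith
      _ ≤ b z.2 * (T⁻¹ * (B * (farRegion n T R).indicator 1 z)) := by gcongr
      _ ≤ 1 * (T⁻¹ * (B * (farRegion n T R).indicator 1 z)) := by gcongr
      _ ≤ _ := by nlinarith [mul_nonneg hTi.le h4]
  · intro z ξ
    rw [(hηd z).fderiv]
    simp only [_root_.add_apply, _root_.smul_apply,
      ContinuousLinearMap.comp_apply, ContinuousLinearMap.coe_snd', ContinuousLinearMap.coe_fst',
      smul_eq_mul, mul_zero, add_zero]
    rw [(hbd z.2).fderiv]
    have key : |(deriv f (2 - ‖z.2‖ ^ 2 / R ^ 2) • -((R ^ 2)⁻¹ • ((2 : ℝ) • innerSL ℝ z.2))) ξ|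
        ≤ 4 * B * R⁻¹ * ‖ξ‖ * (farRegion n T R).indicator 1 z := by
      have e : (deriv f (2 - ‖z.2‖ ^ 2 / R ^ 2) • -((R ^ 2)⁻¹ • ((2 : ℝ) • innerSL ℝ z.2))) ξ
          = -(deriv f (2 - ‖z.2‖ ^ 2 / R ^ 2) * ((R ^ 2)⁻¹ * (2 * inner ℝ z.2 ξ))) := by
        simp
      have hind : 0 ≤ (farRegion n T R).indicator (1 : SpaceTime n → ℝ) z :=
        Set.indicator_nonneg (fun _ _ => zero_le_one) _
      rw [e, abs_neg, abs_mul, abs_mul, abs_mul, abs_of_pos (by positivity : 0 < (R ^ 2)⁻¹), abs_two]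
      by_cases h1 : 2 < ‖z.2‖ ^ 2 / R ^ 2
      · rw [Real.smoothTransition.deriv_eq_zero_of_neg (by linarith)]
        simp only [abs_zero, zero_mul]
        positivity
      by_cases h2 : ‖z.2‖ ^ 2 / R ^ 2 < 1
      · rw [Real.smoothTransition.deriv_eq_zero_of_one_lt (by linarith)]
        simp only [abs_zero, zero_mul]
        positivity
      rw [not_lt, div_le_iff₀ (by positivity)] at h1
      rw [not_lt, le_div_iff₀ (by positivity)] at h2
      have hn1 : ‖z.2‖ ≤ 2 * R := by nlinarith [norm_nonneg z.2]
      have hn2 : R ≤ ‖z.2‖ := by nlinarith [norm_nonneg z.2]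
      have hz : z ∈ farRegion n T R := Or.inr hn2
      rw [Set.indicator_of_mem hz, Pi.one_apply, mul_one]
      calc _ ≤ B * ((R ^ 2)⁻¹ * (2 * (‖z.2‖ * ‖ξ‖))) := by
            gcongr
            · exact hB _
            · exact abs_real_inner_le_norm _ _
        _ ≤ B * ((R ^ 2)⁻¹ * (2 * (2 * R * ‖ξ‖))) := by gcongr
        _ = _ := by field_simp; ring
    have h0 : 0 ≤ 4 * B * R⁻¹ * ‖ξ‖ * (farRegion n T R).indicator 1 z := (abs_nonneg _).trans key
    calc _ ≤ a z.1 * (4 * B * R⁻¹ * ‖ξ‖ * (farRegion n T R).indicator 1 z) := by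
          exact mul_le_mul_of_nonneg_left ((le_abs_self _).trans key) (ha0 _)
      _ ≤ 1 * (4 * B * R⁻¹ * ‖ξ‖ * (farRegion n T R).indicator 1 z) :=
          mul_le_mul_of_nonneg_right (ha1 _) h0
      _ = _ := one_mul _

/-! ### Absorption at scale `r` -/

/-- The flux bound is invariant under scaling because q = (q - p + 1)/p + (q + 1)(p - 1)/p. -/
theorem flux_bound_scaled {p q r B F' η a' : ℝ} (hp : 1 < p) (hr : 0 < r) (hF : 0 ≤ F')
    (h : r ^ q * a' ≤ B * r ^ ((q - p + 1) / p) * (r ^ (q + 1) * F') ^ ((p - 1) / p) * η) :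
    a' ≤ B * F' ^ ((p - 1) / p) * η := by
  have hrq : 0 < r ^ q := by positivity
  rw [Real.mul_rpow (by positivity) hF, ← Real.rpow_mul hr.le] at h
  have e : r ^ q = r ^ ((q - p + 1) / p) * r ^ ((q + 1) * ((p - 1) / p)) := by
    rw [← Real.rpow_add hr]; congr 1; field_simp; ring
  refine le_of_mul_le_mul_left ?_ hrq
  calc r ^ q * a' ≤ _ := h
    _ = r ^ ((q - p + 1) / p) * r ^ ((q + 1) * ((p - 1) / p)) * (B * F' ^ ((p - 1) / p) * η) := by
      ring
    _ = _ := by rw [← e]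

/-- Substituting w = r w', F = r^(q+1) F', G = r^q G', a = r^q a', τ = r^(q-1) τ' makes every term
on the left homogeneous of degree q - s in r, so the unit-scale estimate applies. -/
theorem exists_weighted_absorption_scaled {p q s k B c : ℝ} (hp : 1 < p) (hp2 : p ≤ 2)
    (hs : 0 < s) (hsp : s < p - 1) (hsq : s < q - 1) (hk : p ≤ k)
    (hk1 : q - s ≤ k * (q - 1)) (hk2 : p * (q - s) ≤ k * (q - p + 1)) (hB : 0 ≤ B) (hc : 0 < c) :
    ∃ C : ℝ, 0 ≤ C ∧ ∀ r l w F η τ a G : ℝ, 0 < r → 0 < l → l ≤ 1 → 0 ≤ w → 0 ≤ F → 0 ≤ η → η ≤ 1 →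
      -τ ≤ B * r ^ (q - 1) * η ^ (k - 1) →
      a ≤ B * r ^ ((q - p + 1) / p) * F ^ ((p - 1) / p) * η ^ (k - 1) → c * w ^ q ≤ G →
      -((w + l * r) ^ (1 - s) / (1 - s) * τ) - s * ((w + l * r) ^ (-s - 1) * F * η ^ k)
          + (w + l * r) ^ (-s) * a - G * (w + l * r) ^ (-s) * η ^ k ≤
        -(s / 2 * ((w + l * r) ^ (-s - 1) * F * η ^ k)) + C * r ^ (q - s) := by
  obtain ⟨C, hC0, hC⟩ := exists_weighted_absorption hp hp2 hs hsp hsq hk hk1 hk2 hB hc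
  refine ⟨C, hC0, fun r l w F η τ a G hr hl hl1 hw hF hη hη1 hτ ha hG => ?_⟩
  obtain ⟨w, rfl⟩ : ∃ w', w = r * w' := ⟨w / r, by field_simp⟩
  obtain ⟨F, rfl⟩ : ∃ F', F = r ^ (q + 1) * F' := ⟨F / r ^ (q + 1), by field_simp⟩
  obtain ⟨G, rfl⟩ : ∃ G', G = r ^ q * G' := ⟨G / r ^ q, by field_simp⟩
  obtain ⟨a, rfl⟩ : ∃ a', a = r ^ q * a' := ⟨a / r ^ q, by field_simp⟩
  obtain ⟨τ, rfl⟩ : ∃ τ', τ = r ^ (q - 1) * τ' := ⟨τ / r ^ (q - 1), by field_simp⟩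
  have hrq : 0 < r ^ q := by positivity
  have hw' : 0 ≤ w := nonneg_of_mul_nonneg_right hw hr
  have hF' : 0 ≤ F := nonneg_of_mul_nonneg_right hF (by positivity)
  have hτ' : -τ ≤ B * η ^ (k - 1) := by
    refine le_of_mul_le_mul_left ?_ (by positivity : 0 < r ^ (q - 1))
    linarith
  have ha' := flux_bound_scaled hp hr hF' ha
  have hG' : c * w ^ q ≤ G := by
    rw [Real.mul_rpow hr.le hw'] at hG
    refine le_of_mul_le_mul_left ?_ hrq
    linarith
  have h := mul_le_mul_of_nonneg_left (hC l w F η τ a G hl hl1 hw' hF' hη hη1 hτ' ha' hG')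
    (by positivity : 0 ≤ r ^ (q - s))
  have hW : 0 ≤ w + l := by linarith
  have eW : ∀ x : ℝ, (r * w + l * r) ^ x = r ^ x * (w + l) ^ x := fun x => by
    rw [← Real.mul_rpow hr.le hW]; ring_nf
  have e1 : r ^ (1 - s) * r ^ (q - 1) = r ^ (q - s) := by rw [← Real.rpow_add hr]; ring_nf
  have e2 : r ^ (-s - 1) * r ^ (q + 1) = r ^ (q - s) := by rw [← Real.rpow_add hr]; ring_nf
  have e3 : r ^ (-s) * r ^ q = r ^ (q - s) := by rw [← Real.rpow_add hr]; ring_nf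
  rw [eW, eW, eW]
  calc _ = -((r ^ (1 - s) * r ^ (q - 1)) * ((w + l) ^ (1 - s) / (1 - s) * τ))
        - s * ((r ^ (-s - 1) * r ^ (q + 1)) * ((w + l) ^ (-s - 1) * F * η ^ k))
        + (r ^ (-s) * r ^ q) * ((w + l) ^ (-s) * a)
        - (r ^ (-s) * r ^ q) * (G * (w + l) ^ (-s) * η ^ k) := by ring
    _ = r ^ (q - s) * (-((w + l) ^ (1 - s) / (1 - s) * τ)
        - s * ((w + l) ^ (-s - 1) * F * η ^ k) + (w + l) ^ (-s) * a
        - G * (w + l) ^ (-s) * η ^ k) := by rw [e1, e2, e3]; ring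
    _ ≤ _ := h
    _ = -(s / 2 * ((r ^ (-s - 1) * r ^ (q + 1)) * ((w + l) ^ (-s - 1) * F * η ^ k)))
        + C * r ^ (q - s) := by rw [e2]; ring
    _ = _ := by ring

/-- The same substitution, now with degree q. The weighted dissipation has degree only q - s, hence
its factor r^s. -/
theorem exists_unweighted_absorption_scaled {p q s k B c : ℝ} (hp : 1 < p) (hq : 1 < q)
    (hs : 0 < s) (hsq : (s + 1) * (p - 1) < q) (hk : p ≤ k)
    (hk1 : q ≤ k * (q - 1)) (hk2 : p * q ≤ k * (q - (s + 1) * (p - 1))) (hB : 0 ≤ B) (hc : 0 < c) :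
    ∃ C : ℝ, 0 ≤ C ∧ ∀ r l w F η τ a G : ℝ, 0 < r → 0 < l → l ≤ 1 → 0 ≤ w → 0 ≤ F → 0 ≤ η → η ≤ 1 →
      -τ ≤ B * r ^ (q - 1) * η ^ (k - 1) →
      a ≤ B * r ^ ((q - p + 1) / p) * F ^ ((p - 1) / p) * η ^ (k - 1) → c * w ^ q ≤ G →
      -(w * τ) + a - G * η ^ k ≤
        -(c / 2 * (w ^ q * η ^ k)) + r ^ s * ((w + l * r) ^ (-s - 1) * F * η ^ k)
          + C * r ^ q := by
  obtain ⟨C, hC0, hC⟩ := exists_unweighted_absorption hp hq hs hsq hk hk1 hk2 hB hc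
  refine ⟨C, hC0, fun r l w F η τ a G hr hl hl1 hw hF hη hη1 hτ ha hG => ?_⟩
  obtain ⟨w, rfl⟩ : ∃ w', w = r * w' := ⟨w / r, by field_simp⟩
  obtain ⟨F, rfl⟩ : ∃ F', F = r ^ (q + 1) * F' := ⟨F / r ^ (q + 1), by field_simp⟩
  obtain ⟨G, rfl⟩ : ∃ G', G = r ^ q * G' := ⟨G / r ^ q, by field_simp⟩
  obtain ⟨a, rfl⟩ : ∃ a', a = r ^ q * a' := ⟨a / r ^ q, by field_simp⟩
  obtain ⟨τ, rfl⟩ : ∃ τ', τ = r ^ (q - 1) * τ' := ⟨τ / r ^ (q - 1), by field_simp⟩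
  have hrq : 0 < r ^ q := by positivity
  have hw' : 0 ≤ w := nonneg_of_mul_nonneg_right hw hr
  have hF' : 0 ≤ F := nonneg_of_mul_nonneg_right hF (by positivity)
  have hτ' : -τ ≤ B * η ^ (k - 1) := by
    refine le_of_mul_le_mul_left ?_ (by positivity : 0 < r ^ (q - 1))
    linarith
  have ha' := flux_bound_scaled hp hr hF' ha
  have ewq : (r * w) ^ q = r ^ q * w ^ q := Real.mul_rpow hr.le hw'
  have hG' : c * w ^ q ≤ G := by
    rw [ewq] at hG
    refine le_of_mul_le_mul_left ?_ hrq
    linarith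
  have h := mul_le_mul_of_nonneg_left (hC l w F η τ a G hl hl1 hw' hF' hη hη1 hτ' ha' hG') hrq.le
  have hW : 0 ≤ w + l := by linarith
  have eW : (r * w + l * r) ^ (-s - 1) = r ^ (-s - 1) * (w + l) ^ (-s - 1) := by
    rw [← Real.mul_rpow hr.le hW]; ring_nf
  have e1 : r * r ^ (q - 1) = r ^ q := by
    rw [← Real.rpow_one_add' hr.le (by linarith)]; ring_nf
  have e2 : r ^ s * (r ^ (-s - 1) * r ^ (q + 1)) = r ^ q := by
    rw [← Real.rpow_add hr, ← Real.rpow_add hr]; ring_nf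
  rw [eW, ewq]
  calc _ = -((r * r ^ (q - 1)) * (w * τ)) + r ^ q * a - r ^ q * (G * η ^ k) := by ring
    _ = r ^ q * (-(w * τ) + a - G * η ^ k) := by rw [e1]; ring
    _ ≤ _ := h
    _ = -(c / 2 * (r ^ q * w ^ q * η ^ k))
        + (r ^ s * (r ^ (-s - 1) * r ^ (q + 1))) * ((w + l) ^ (-s - 1) * F * η ^ k)
        + C * r ^ q := by rw [e2]; ring
    _ = _ := by ring

theorem exists_annular_absorption_scaled {p q s k B c κ : ℝ} (hp : 1 < p) (hq : 1 < q)
    (hs : 0 < s) (hsq : (s + 1) * (p - 1) < q) (hk : p ≤ k) (hB : 0 ≤ B) (hκ : 0 < κ) :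
    ∃ l : ℝ, 0 < l ∧ l ≤ 1 ∧ ∃ C : ℝ, 0 ≤ C ∧ ∀ r w F η τ a G χ : ℝ, 0 < r → 0 ≤ w → 0 ≤ F →
      0 ≤ η → η ≤ 1 → (χ = 0 ∨ χ = 1) → -τ ≤ B * r ^ (q - 1) * η ^ (k - 1) * χ →
      a ≤ B * r ^ ((q - p + 1) / p) * F ^ ((p - 1) / p) * η ^ (k - 1) * χ → c * w ^ q ≤ G →
      -(w * τ) + a - G * η ^ k ≤
        -(c * (w ^ q * η ^ k)) + κ * (r ^ s * ((w + l * r) ^ (-s - 1) * F * η ^ k))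
          + κ * r ^ q + C * (w ^ q * χ) := by
  obtain ⟨l, hl, hl1, C, hC0, hC⟩ := exists_annular_absorption (c := c) hp hq hs hsq hk hB hκ
  refine ⟨l, hl, hl1, C, hC0, fun r w F η τ a G χ hr hw hF hη hη1 hχ hτ ha hG => ?_⟩
  obtain ⟨w, rfl⟩ : ∃ w', w = r * w' := ⟨w / r, by field_simp⟩
  obtain ⟨F, rfl⟩ : ∃ F', F = r ^ (q + 1) * F' := ⟨F / r ^ (q + 1), by field_simp⟩
  obtain ⟨G, rfl⟩ : ∃ G', G = r ^ q * G' := ⟨G / r ^ q, by field_simp⟩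
  obtain ⟨a, rfl⟩ : ∃ a', a = r ^ q * a' := ⟨a / r ^ q, by field_simp⟩
  obtain ⟨τ, rfl⟩ : ∃ τ', τ = r ^ (q - 1) * τ' := ⟨τ / r ^ (q - 1), by field_simp⟩
  have hrq : 0 < r ^ q := by positivity
  have hw' : 0 ≤ w := nonneg_of_mul_nonneg_right hw hr
  have hF' : 0 ≤ F := nonneg_of_mul_nonneg_right hF (by positivity)
  have hτ' : -τ ≤ B * η ^ (k - 1) * χ := by
    refine le_of_mul_le_mul_left ?_ (by positivity : 0 < r ^ (q - 1))
    linarith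
  rw [mul_assoc _ (η ^ (k - 1)) χ] at ha
  have ha' := flux_bound_scaled hp hr hF' ha
  rw [← mul_assoc] at ha'
  have ewq : (r * w) ^ q = r ^ q * w ^ q := Real.mul_rpow hr.le hw'
  have hG' : c * w ^ q ≤ G := by
    rw [ewq] at hG
    refine le_of_mul_le_mul_left ?_ hrq
    linarith
  have h := mul_le_mul_of_nonneg_left (hC w F η τ a G χ hw' hF' hη hη1 hχ hτ' ha' hG') hrq.le
  have hW : 0 ≤ w + l := by linarith
  have eW : (r * w + l * r) ^ (-s - 1) = r ^ (-s - 1) * (w + l) ^ (-s - 1) := by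
    rw [← Real.mul_rpow hr.le hW]; ring_nf
  have e1 : r * r ^ (q - 1) = r ^ q := by
    rw [← Real.rpow_one_add' hr.le (by linarith)]; ring_nf
  have e2 : r ^ s * (r ^ (-s - 1) * r ^ (q + 1)) = r ^ q := by
    rw [← Real.rpow_add hr, ← Real.rpow_add hr]; ring_nf
  rw [eW, ewq]
  calc _ = -((r * r ^ (q - 1)) * (w * τ)) + r ^ q * a - r ^ q * (G * η ^ k) := by ring
    _ = r ^ q * (-(w * τ) + a - G * η ^ k) := by rw [e1]; ring
    _ ≤ _ := h
    _ = -(c * (r ^ q * w ^ q * η ^ k))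
        + κ * ((r ^ s * (r ^ (-s - 1) * r ^ (q + 1))) * ((w + l) ^ (-s - 1) * F * η ^ k))
        + κ * r ^ q + C * (r ^ q * w ^ q * χ) := by rw [e2]; ring
    _ = _ := by ring

/-! ### Local integrability -/

theorem MeasureTheory.LocallyIntegrableOn.mono_of_ae_restrict {X : Type*} [TopologicalSpace X]
    [MeasurableSpace X] [OpensMeasurableSpace X] {μ : Measure X} {Ω : Set X}
    {f g : X → ℝ} (hf : LocallyIntegrableOn f Ω μ) (hg : AEStronglyMeasurable g (μ.restrict Ω))
    (h : ∀ᵐ z ∂μ.restrict Ω, |g z| ≤ f z) : LocallyIntegrableOn g Ω μ := by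
  intro x hx
  obtain ⟨t, ht, hft⟩ := hf x hx
  refine ⟨t ∩ Ω, Filter.inter_mem ht self_mem_nhdsWithin, ?_⟩
  exact (hft.mono_set Set.inter_subset_left).mono' (hg.mono_set Set.inter_subset_right)
    (ae_restrict_of_ae_restrict_of_subset Set.inter_subset_right h)

theorem MeasureTheory.LocallyIntegrableOn.integrableOn_mul_of_tsupport_subset {X : Type*} [TopologicalSpace X]
    [T2Space X] [MeasurableSpace X] [BorelSpace X] {μ : Measure X} {Ω : Set X}
    {f ψ : X → ℝ} (hf : LocallyIntegrableOn f Ω μ)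
    (hψ : Continuous ψ) (hc : HasCompactSupport ψ) (hs : tsupport ψ ⊆ Ω) :
    IntegrableOn (fun z => f z * ψ z) Ω μ := by
  have h1 : IntegrableOn (fun z => f z * ψ z) (tsupport ψ) μ :=
    (hf.integrableOn_compact_subset hs hc).mul_continuousOn hψ.continuousOn hc
  have h2 : Function.support (fun z => f z * ψ z) ⊆ tsupport ψ := fun z hz =>
    subset_tsupport _ (right_ne_zero_of_mul hz)
  exact ((integrableOn_iff_integrable_of_support_subset h2).mp h1).integrableOn

section TestFunctionIntegrability

variable {E : Type*} [NormedAddCommGroup E] [NormedSpace ℝ E] [MeasurableSpace E] [BorelSpace E]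
  {μ : Measure E} {Ω : Opens E} {f : E → ℝ}

theorem MeasureTheory.LocallyIntegrableOn.integrableOn_mul_testFunction (hf : LocallyIntegrableOn f Ω μ)
    (φ : TestFunction Ω ℝ (⊤ : ℕ∞)) : IntegrableOn (fun z => f z * φ z) Ω μ :=
  hf.integrableOn_mul_of_tsupport_subset φ.continuous φ.hasCompactSupport φ.tsupport_subset

theorem MeasureTheory.LocallyIntegrableOn.integrableOn_mul_fderiv_testFunction (hf : LocallyIntegrableOn f Ω μ)
    (φ : TestFunction Ω ℝ (⊤ : ℕ∞)) (e : E) :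
    IntegrableOn (fun z => f z * fderiv ℝ φ z e) Ω μ :=
  hf.integrableOn_mul_of_tsupport_subset (φ.continuous_fderiv_apply e)
    (φ.hasCompactSupport.fderiv_apply ℝ e)
    ((tsupport_fderiv_apply_subset ℝ e).trans φ.tsupport_subset)

end TestFunctionIntegrability

theorem HasWeakDirDeriv.add {E : Type*} [NormedAddCommGroup E] [NormedSpace ℝ E] [MeasureSpace E]
    [BorelSpace E] {Ω : Opens E} {e : E} {f g f' g' : E → ℝ} (h : HasWeakDirDeriv Ω e f g)
    (h' : HasWeakDirDeriv Ω e f' g') :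
    HasWeakDirDeriv Ω e (fun z => f z + f' z) (fun z => g z + g' z) := by
  refine ⟨h.1.add h'.1, h.2.1.add h'.2.1, fun φ => ?_⟩
  simp_rw [add_mul]
  rw [integral_add (h.1.integrableOn_mul_fderiv_testFunction φ e)
    (h'.1.integrableOn_mul_fderiv_testFunction φ e),
    integral_add (h.2.1.integrableOn_mul_testFunction φ) (h'.2.1.integrableOn_mul_testFunction φ),
    h.2.2 φ, h'.2.2 φ]
  ring

theorem add_rpow_le_two_rpow_mul {a x y : ℝ} (ha : 0 ≤ a) (hx : 0 ≤ x) (hy : 0 ≤ y) :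
    (x + y) ^ a ≤ 2 ^ a * (x ^ a + y ^ a) := by
  have hxa := Real.rpow_nonneg hx a
  have hya := Real.rpow_nonneg hy a
  rcases le_total x y with h | h
  · calc (x + y) ^ a ≤ (2 * y) ^ a := Real.rpow_le_rpow (by linarith) (by linarith) ha
      _ = 2 ^ a * y ^ a := Real.mul_rpow (by norm_num) hy
      _ ≤ _ := by gcongr; linarith
  · calc (x + y) ^ a ≤ (2 * x) ^ a := Real.rpow_le_rpow (by linarith) (by linarith) ha
      _ = 2 ^ a * x ^ a := Real.mul_rpow (by norm_num) hx
      _ ≤ _ := by gcongr; linarith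

theorem le_one_add_rpow {a x : ℝ} (ha : 1 ≤ a) (hx : 0 ≤ x) : x ≤ 1 + x ^ a := by
  rcases le_total x 1 with h | h
  · linarith [Real.rpow_nonneg hx a]
  · linarith [Real.self_le_rpow_of_one_le h ha]

/-! ### The differential inequality for the difference of the solutions -/

theorem norm_pLaplace_flux {E : Type*} [NormedAddCommGroup E] [NormedSpace ℝ E] {p : ℝ}
    (hp : 1 < p) (ξ : E) : ‖‖ξ‖ ^ (p - 2) • ξ‖ = ‖ξ‖ ^ (p - 1) := by
  rcases eq_or_ne ξ 0 with rfl | h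
  · simp [Real.zero_rpow (by linarith : p - 1 ≠ 0)]
  have hn : 0 < ‖ξ‖ := norm_pos_iff.mpr h
  rw [norm_smul, Real.norm_of_nonneg (by positivity), ← Real.rpow_add_one hn.ne']
  congr 1; ring

/-- The differential inequality `w_t - div A ≥ G` satisfied by the difference `w ≥ 0` of a super-
and a sub-solution, with spatial gradient `D`, flux difference `A` and source difference `G`. -/
structure IsDifferenceSystem (n : ℕ) (p q K c : ℝ) (w wt G : SpaceTime n → ℝ)
    (A D : SpaceTime n → EuclideanSpace ℝ (Fin n)) : Prop where
  weak_time : HasWeakDirDeriv (halfSpace n) (timeDir n) w wt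
  weak_space : ∀ i : Fin n, HasWeakDirDeriv (halfSpace n) (spaceDir i) w (fun z => D z i)
  grad_pow : ∀ i, LocallyIntegrableOn (fun z => |D z i| ^ p) (halfSpace n)
  flux_loc : ∀ i, LocallyIntegrableOn (fun z => A z i) (halfSpace n)
  flux_pow : ∀ i, LocallyIntegrableOn (fun z => |A z i| ^ (p / (p - 1))) (halfSpace n)
  source_loc : LocallyIntegrableOn G (halfSpace n)
  nonneg : ∀ᵐ z ∂volume.restrict (halfSpace n : Set (SpaceTime n)), 0 ≤ w z
  test : ∀ φ : TestFunction (halfSpace n) ℝ (⊤ : ℕ∞), (∀ z, 0 ≤ φ z) →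
      0 ≤ ∫ z in (halfSpace n : Set (SpaceTime n)),
        (wt z * φ z + ∑ i, A z i * fderiv ℝ φ z (spaceDir i) - G z * φ z)
  dissipation_nonneg : ∀ z, 0 ≤ ∑ i, A z i * D z i
  flux_le : ∀ z, ‖A z‖ ≤ K * (∑ i, A z i * D z i) ^ ((p - 1) / p)
  source_ge : ∀ᵐ z ∂volume.restrict (halfSpace n : Set (SpaceTime n)), c * w z ^ q ≤ G z

theorem aestronglyMeasurable_norm_of_coord {n : ℕ} {X : Type*} [MeasurableSpace X] {μ : Measure X}
    {D : X → EuclideanSpace ℝ (Fin n)} (h : ∀ i, AEStronglyMeasurable (fun z => D z i) μ) :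
    AEStronglyMeasurable (fun z => ‖D z‖) μ := by
  simp_rw [EuclideanSpace.norm_eq]
  refine Real.continuous_sqrt.comp_aestronglyMeasurable ?_
  exact Finset.aestronglyMeasurable_fun_sum _ fun i _ => (h i).norm.pow 2

/-- The inequalities for u and for -v are added. The flux and the source are odd, so the sums are
the differences for u and v, to which the monotonicity inequalities apply. -/
theorem exists_isDifferenceSystem {n : ℕ} {p q : ℝ} (hp : 1 < p) (hp2 : p ≤ 2) (hq : 1 < q)
    {u v : SpaceTime n → ℝ} (hu : IsEntireWeakSuperSolution n p q u)
    (hv : IsEntireWeakSubSolution n p q v)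
    (huv : ∀ᵐ z ∂volume.restrict (halfSpace n : Set (SpaceTime n)), v z ≤ u z) :
    ∃ K : ℝ, 0 ≤ K ∧ ∃ wt G A D, IsDifferenceSystem n p q K (2 ^ (-q))
      (fun z => u z + -v z) wt G A D := by
  obtain ⟨hum, huq, ut, Du, hut, hDu, hDup, husup⟩ := hu
  obtain ⟨hbm, hbq, bt, Db, hbt, hDb, hDbp, hbsup⟩ := hv
  set Ω := halfSpace n with hΩ
  have hp1 : 0 < p - 1 := by linarith
  set p' := p / (p - 1) with hp'
  have hp'1 : 1 ≤ p' := by rw [hp', le_div_iff₀ hp1]; linarith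
  have hp'0 : 0 ≤ p' := by linarith
  have hΩo : IsOpen (Ω : Set (SpaceTime n)) := Ω.isOpen
  have hΩm : MeasurableSet (Ω : Set (SpaceTime n)) := hΩo.measurableSet
  have hone : LocallyIntegrableOn (fun _ : SpaceTime n => (1 : ℝ)) Ω :=
    (locallyIntegrable_const (1 : ℝ)).locallyIntegrableOn _
  have mDu : ∀ i, AEStronglyMeasurable (fun z => Du z i) (volume.restrict (Ω : Set (SpaceTime n))) :=
    fun i => (hDu i).2.1.aestronglyMeasurable
  have mDb : ∀ i, AEStronglyMeasurable (fun z => Db z i) (volume.restrict (Ω : Set (SpaceTime n))) :=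
    fun i => (hDb i).2.1.aestronglyMeasurable
  have flux : ∀ (D : SpaceTime n → EuclideanSpace ℝ (Fin n)),
      (∀ i, AEStronglyMeasurable (fun z => D z i) (volume.restrict (Ω : Set (SpaceTime n)))) →
      LocallyIntegrableOn (fun z => ‖D z‖ ^ p) Ω → ∀ i,
      AEStronglyMeasurable (fun z => ‖D z‖ ^ (p - 2) * D z i)
        (volume.restrict (Ω : Set (SpaceTime n))) ∧
      LocallyIntegrableOn (fun z => ‖D z‖ ^ (p - 2) * D z i) Ω := by
    intro D hD hDp i
    have m : AEStronglyMeasurable (fun z => ‖D z‖ ^ (p - 2) * D z i)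
        (volume.restrict (Ω : Set (SpaceTime n))) :=
      ((aestronglyMeasurable_norm_of_coord hD).aemeasurable.pow_const _).aestronglyMeasurable.mul
        (hD i)
    refine ⟨m, LocallyIntegrableOn.mono_of_ae_restrict (hone.add hDp) m
      (Filter.Eventually.of_forall fun z => ?_)⟩
    have h1 : |‖D z‖ ^ (p - 2) * D z i| ≤ ‖D z‖ ^ (p - 1) := by
      rw [← norm_pLaplace_flux hp (D z)]
      exact PiLp.norm_apply_le (‖D z‖ ^ (p - 2) • D z) i
    have h2 := le_one_add_rpow hp'1 (Real.rpow_nonneg (norm_nonneg (D z)) (p - 1))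
    rw [← Real.rpow_mul (norm_nonneg _), show (p - 1) * p' = p by rw [hp']; field_simp] at h2
    exact h1.trans h2
  have source : ∀ (f : SpaceTime n → ℝ),
      AEStronglyMeasurable f (volume.restrict (Ω : Set (SpaceTime n))) →
      LocallyIntegrableOn (fun z => |f z| ^ q) Ω →
      LocallyIntegrableOn (fun z => |f z| ^ (q - 1) * f z) Ω := by
    intro f hf hfq
    refine LocallyIntegrableOn.mono_of_ae_restrict hfq
      ((hf.norm.aemeasurable.pow_const _).aestronglyMeasurable.mul hf)
      (Filter.Eventually.of_forall fun z => ?_)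
    rw [abs_mul, abs_of_nonneg (Real.rpow_nonneg (abs_nonneg _) _)]
    conv_lhs => rw [← Real.rpow_one |f z|]
    rw [Real.rpow_one]
    refine le_of_eq ?_
    conv_rhs => rw [show q = q - 1 + 1 by ring]
    rw [Real.rpow_add_one' (abs_nonneg _) (by linarith)]
  set A : SpaceTime n → EuclideanSpace ℝ (Fin n) :=
    fun z => ‖Du z‖ ^ (p - 2) • Du z + ‖Db z‖ ^ (p - 2) • Db z with hA
  have hAi : ∀ z i, A z i = ‖Du z‖ ^ (p - 2) * Du z i + ‖Db z‖ ^ (p - 2) * Db z i := by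
    intro z i; simp [hA]
  -- `Db` is the gradient of -v, so monotonicity is used at `Du` and `-Db`.
  have mono : ∀ z, 2 ^ (1 - p') * ‖A z‖ ^ p' ≤ ∑ i, A z i * (Du z + Db z) i := by
    intro z
    have h := norm_pLaplace_flux_sub_rpow_le hp hp2 (Du z) (-Db z)
    rw [norm_neg, smul_neg, sub_neg_eq_add, sub_neg_eq_add] at h
    refine h.trans_eq ?_
    rw [PiLp.inner_apply]
    refine Finset.sum_congr rfl fun i _ => ?_
    simp [hA, mul_comm]
  have hF0 : ∀ z, 0 ≤ ∑ i, A z i * (Du z + Db z) i := fun z => le_trans (by positivity) (mono z)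
  refine ⟨(2 ^ (p' - 1)) ^ ((p - 1) / p), by positivity, fun z => ut z + bt z,
    fun z => |u z| ^ (q - 1) * u z + |-v z| ^ (q - 1) * -v z, A, fun z => Du z + Db z, ?_⟩
  have hAloc : ∀ i, LocallyIntegrableOn (fun z => A z i) Ω := fun i => by
    simp_rw [hAi]
    exact (flux Du mDu hDup i).2.add (flux Db mDb hDbp i).2
  refine ⟨hut.add hbt, fun i => ?_, fun i => ?_, hAloc, fun i => ?_,
    (source u hum huq).add (source _ hbm hbq), ?_, ?_, hF0, fun z => ?_, ?_⟩
  · exact (hDu i).add (hDb i)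
  · refine LocallyIntegrableOn.mono_of_ae_restrict ((hDup.add hDbp).smul ((2 : ℝ) ^ p)) ?_
      (Filter.Eventually.of_forall fun z => ?_)
    · exact (((mDu i).add (mDb i)).norm.aemeasurable.pow_const _).aestronglyMeasurable
    · have h1 : |(Du z + Db z) i| ≤ ‖Du z‖ + ‖Db z‖ :=
        (PiLp.norm_apply_le (Du z + Db z) i).trans (norm_add_le _ _)
      rw [abs_of_nonneg (Real.rpow_nonneg (abs_nonneg _) _)]
      exact (Real.rpow_le_rpow (abs_nonneg _) h1 (by linarith)).trans
        (add_rpow_le_two_rpow_mul (by linarith) (norm_nonneg _) (norm_nonneg _))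
  · refine LocallyIntegrableOn.mono_of_ae_restrict ((hDup.add hDbp).smul ((2 : ℝ) ^ p')) ?_
      (Filter.Eventually.of_forall fun z => ?_)
    · exact ((hAloc i).aestronglyMeasurable.norm.aemeasurable.pow_const _).aestronglyMeasurable
    · have h1 : |A z i| ≤ ‖Du z‖ ^ (p - 1) + ‖Db z‖ ^ (p - 1) := by
        refine (PiLp.norm_apply_le (A z) i).trans ((norm_add_le _ _).trans_eq ?_)
        rw [norm_pLaplace_flux hp, norm_pLaplace_flux hp]
      rw [abs_of_nonneg (Real.rpow_nonneg (abs_nonneg _) _)]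
      refine (Real.rpow_le_rpow (abs_nonneg _) h1 hp'0).trans ?_
      refine (add_rpow_le_two_rpow_mul hp'0 (by positivity) (by positivity)).trans_eq ?_
      rw [← Real.rpow_mul (norm_nonneg _), ← Real.rpow_mul (norm_nonneg _),
        show (p - 1) * p' = p by rw [hp']; field_simp]
      rfl
  · filter_upwards [huv] with z hz
    linarith
  · intro φ hφ
    have key : ∀ (f ft : SpaceTime n → ℝ) (D : SpaceTime n → EuclideanSpace ℝ (Fin n)),
        LocallyIntegrableOn ft Ω → (∀ i, LocallyIntegrableOn (fun z => ‖D z‖ ^ (p - 2) * D z i) Ω) →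
        LocallyIntegrableOn (fun z => |f z| ^ (q - 1) * f z) Ω →
        IntegrableOn (fun z => ft z * φ z
          + ∑ i : Fin n, ‖D z‖ ^ (p - 2) * D z i * fderiv ℝ φ z (spaceDir i)
          - |f z| ^ (q - 1) * f z * φ z) Ω := by
      intro f ft D h1 h2 h3
      exact ((h1.integrableOn_mul_testFunction φ).add (integrable_finsetSum _ fun i _ =>
        (h2 i).integrableOn_mul_fderiv_testFunction φ _)).sub (h3.integrableOn_mul_testFunction φ)
    have i1 := key u ut Du hut.2.1 (fun i => (flux Du mDu hDup i).2) (source u hum huq)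
    have i2 := key (fun z => -v z) bt Db hbt.2.1 (fun i => (flux Db mDb hDbp i).2)
      (source _ hbm hbq)
    have h := add_nonneg (husup φ hφ) (hbsup φ hφ)
    rw [← integral_add i1 i2] at h
    refine h.trans_eq ?_
    congr 1; ext z
    simp_rw [hAi, add_mul, Finset.sum_add_distrib]
    ring
  · have hp0 : 0 < p := by linarith
    -- Raising this to the power (p - 1)/p = 1/p' yields the flux bound and the stated value of K.
    have h1 : ‖A z‖ ^ p' ≤ 2 ^ (p' - 1) * ∑ i, A z i * (Du z + Db z) i := by
      have h2 := mul_le_mul_of_nonneg_left (mono z) (by positivity : (0 : ℝ) ≤ 2 ^ (p' - 1))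
      rw [← mul_assoc, ← Real.rpow_add (by norm_num), show p' - 1 + (1 - p') = 0 by ring,
        Real.rpow_zero, one_mul] at h2
      exact h2
    have h2 := Real.rpow_le_rpow (by positivity) h1 (by positivity : 0 ≤ (p - 1) / p)
    rwa [← Real.rpow_mul (norm_nonneg _), show p' * ((p - 1) / p) = 1 by rw [hp']; field_simp,
      Real.rpow_one, Real.mul_rpow (by positivity) (hF0 z)] at h2
  · filter_upwards [huv] with z hz
    have h := abs_rpow_mul_sub_ge hq hz
    rw [abs_neg, mul_neg]
    exact h

/-! ### Integral estimates -/

theorem MeasureTheory.LocallyIntegrableOn.finsetSum {X ι : Type*} [TopologicalSpace X]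
    [MeasurableSpace X] {μ : Measure X} {Ω : Set X} {f : ι → X → ℝ} (s : Finset ι)
    (h : ∀ i ∈ s, LocallyIntegrableOn (f i) Ω μ) :
    LocallyIntegrableOn (fun z => ∑ i ∈ s, f i z) Ω μ := by
  classical
  induction s using Finset.induction_on with
  | empty => simpa using locallyIntegrableOn_zero
  | insert a s ha ih =>
    simp_rw [Finset.sum_insert ha]
    exact (h a (Finset.mem_insert_self _ _)).add
      (ih fun i hi => h i (Finset.mem_insert_of_mem hi))

instance SpaceTime.isAddHaarMeasure_volume (n : ℕ) :
    (volume : Measure (SpaceTime n)).IsAddHaarMeasure :=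
  inferInstanceAs ((volume : Measure ℝ).prod
    (volume : Measure (EuclideanSpace ℝ (Fin n)))).IsAddHaarMeasure

/-- Relations between the exponents of the equation, the exponent `s` of the weight and the power
`k` of the cutoff. -/
structure AdmissibleExponents (p q s : ℝ) (k : ℕ) : Prop where
  one_lt_p : 1 < p
  p_le_two : p ≤ 2
  one_lt_q : 1 < q
  s_pos : 0 < s
  s_lt_p : s < p - 1
  s_lt_q : s < q - 1
  weight_lt : (s + 1) * (p - 1) < q
  le_k : p ≤ k
  time_k : q ≤ k * (q - 1)
  space_k : p * q ≤ k * (q - (s + 1) * (p - 1))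

/-- Taking s below both p - 1 and q - 1 gives (s + 1)(p - 1) ≤ s + 1 < q, as p ≤ 2. The remaining
conditions only bound k from below. -/
theorem exists_admissibleExponents {p q : ℝ} (hp : 1 < p) (hp2 : p ≤ 2) (hq : 1 < q) :
    ∃ s k, AdmissibleExponents p q s k := by
  have h1 : 0 < min (p - 1) (q - 1) := lt_min (by linarith) (by linarith)
  set s := min (p - 1) (q - 1) / 2 with hs
  have hs0 : 0 < s := by positivity
  have hsp : s < p - 1 := by linarith [min_le_left (p - 1) (q - 1)]
  have hsq : s < q - 1 := by linarith [min_le_right (p - 1) (q - 1)]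
  have hm : (s + 1) * (p - 1) < q := by nlinarith
  have hm' : 0 < q - (s + 1) * (p - 1) := by linarith
  have hq' : 0 < q - 1 := by linarith
  obtain ⟨k, hk⟩ := exists_nat_ge (p + q / (q - 1) + p * q / (q - (s + 1) * (p - 1)))
  have e1 : 0 < q / (q - 1) := by positivity
  have e2 : 0 < p * q / (q - (s + 1) * (p - 1)) := by positivity
  refine ⟨s, k, hp, hp2, hq, hs0, hsp, hsq, hm, by linarith, ?_, ?_⟩
  · rw [← div_le_iff₀ hq']; linarith
  · rw [← div_le_iff₀ hm']; linarith

/-- A space-time cylinder. -/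
def spaceTimeCylinder (n : ℕ) (T R : ℝ) : Set (SpaceTime n) := Set.Icc 0 (2 * T) ×ˢ Metric.closedBall 0 (2 * R)

theorem isCompact_cylinder (n : ℕ) (T R : ℝ) : IsCompact (spaceTimeCylinder n T R) :=
  isCompact_Icc.prod (isCompact_closedBall _ _)

theorem volume_real_cylinder (n : ℕ) {T R : ℝ} (hT : 0 ≤ T) (hR : 0 ≤ R) :
    volume.real (spaceTimeCylinder n T R) = 2 * T * ((2 * R) ^ n *
      volume.real (Metric.ball (0 : EuclideanSpace ℝ (Fin n)) 1)) := by
  unfold spaceTimeCylinder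
  rw [Measure.volume_eq_prod, measureReal_prod_prod, Measure.addHaar_real_closedBall _ _ (by linarith),
    Real.volume_real_Icc_of_le (by linarith), finrank_euclideanSpace_fin, sub_zero]

/-- `ζ = η ^ k` for a cutoff `η` which decreases only on the far region, at rate `B / T` in time and
`B / R` in space. -/
structure IsScaledCutoff (n k : ℕ) (B T R τ : ℝ) (ζ : TestFunction (halfSpace n) ℝ (⊤ : ℕ∞))
    (η : SpaceTime n → ℝ) : Prop where
  nonneg : ∀ z, 0 ≤ η z
  le_one : ∀ z, η z ≤ 1
  eq_rpow : ∀ z, ζ z = η z ^ (k : ℝ)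
  eq_zero : ∀ z, z ∉ spaceTimeCylinder n T R → ζ z = 0 ∧ fderiv ℝ ζ z = 0
  eq_one : ∀ z, 2 * τ ≤ z.1 → z.1 ≤ T → ‖z.2‖ ≤ R → ζ z = 1
  time_le : ∀ z, -fderiv ℝ ζ z (timeDir n) ≤
    B * T⁻¹ * η z ^ ((k : ℝ) - 1) * (farRegion n T R).indicator 1 z
  space_le : ∀ z (a : EuclideanSpace ℝ (Fin n)), ∑ i, a i * fderiv ℝ ζ z (spaceDir i) ≤
    B * R⁻¹ * ‖a‖ * η z ^ ((k : ℝ) - 1) * (farRegion n T R).indicator 1 z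

theorem sum_mul_apply_spaceDir {n : ℕ} (L : SpaceTime n →L[ℝ] ℝ) (a : EuclideanSpace ℝ (Fin n)) :
    ∑ i, a i * L (spaceDir i) = L (0, a) := by
  have h : ((0, a) : SpaceTime n) = ∑ i, a i • spaceDir i := by
    refine Prod.ext ?_ ?_
    · simp [spaceDir, Prod.fst_sum]
    · ext j
      simp [spaceDir, Prod.snd_sum, Pi.single_apply]
  rw [h, map_sum]
  simp

/-- Differentiating η^k keeps a factor η^(k-1), needed by the absorption lemmas, and produces the
factor k in the constant. For k ≥ 2 this factor makes the derivative vanish wherever η does. -/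
theorem exists_isScaledCutoff (n k : ℕ) (hk : 2 ≤ k) : ∃ B : ℝ, 0 ≤ B ∧ ∀ T R τ : ℝ, 0 < T → 0 < R →
    0 < τ → ∃ ζ η, IsScaledCutoff n k B T R τ ζ η := by
  obtain ⟨B, hB0, hB⟩ := exists_cutoff n
  refine ⟨k * B, by positivity, fun T R τ hT hR hτ => ?_⟩
  obtain ⟨η, hηs, hη0, hη1, hsupp, hone, htime, hspace⟩ := hB T R τ hT hR hτ
  have hd : ∀ z, HasFDerivAt (fun z => η z ^ k) ((k * η z ^ (k - 1)) • fderiv ℝ η z) z := fun z => by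
    simpa using (hηs.differentiable (by simp) z).hasFDerivAt.pow k
  have hsub : Function.support (fun z => η z ^ k) ⊆ Set.Icc τ (2 * T) ×ˢ Metric.closedBall 0 (2 * R) := by
    intro z hz
    have hz' : η z ≠ 0 := fun h => hz (by simp [h, show k ≠ 0 by omega])
    obtain ⟨h1, h2, h3⟩ := hsupp z hz'
    exact ⟨⟨h1, h2⟩, by simpa using h3⟩
  have hcomp : IsCompact (Set.Icc τ (2 * T) ×ˢ
      Metric.closedBall (0 : EuclideanSpace ℝ (Fin n)) (2 * R)) :=
    isCompact_Icc.prod (isCompact_closedBall _ _)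
  have htsub : tsupport (fun z => η z ^ k) ⊆ Set.Icc τ (2 * T) ×ˢ Metric.closedBall 0 (2 * R) :=
    closure_minimal hsub hcomp.isClosed
  let ζ : TestFunction (halfSpace n) ℝ (⊤ : ℕ∞) :=
    ⟨fun z => η z ^ k, hηs.pow k, HasCompactSupport.of_support_subset_isCompact hcomp hsub,
      htsub.trans fun z hz => ⟨hτ.trans_le hz.1.1, Set.mem_univ _⟩⟩
  have hζ : ∀ z, ζ z = η z ^ k := fun z => rfl
  have hζd : ∀ z, fderiv ℝ ζ z = (k * η z ^ (k - 1)) • fderiv ℝ η z := fun z => (hd z).fderiv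
  have hpow : ∀ z, η z ^ ((k : ℝ) - 1) = η z ^ (k - 1) := fun z => by
    rw [← Real.rpow_natCast, Nat.cast_sub (by omega), Nat.cast_one]
  refine ⟨ζ, η, hη0, hη1, fun z => by rw [hζ, Real.rpow_natCast], ?_, ?_, ?_, ?_⟩
  · intro z hz
    have h0 : η z = 0 := by
      by_contra h
      obtain ⟨h1, h2, h3⟩ := hsupp z h
      exact hz ⟨⟨hτ.le.trans h1, h2⟩, by simpa using h3⟩
    rw [hζ, hζd, h0]
    simp [show k ≠ 0 by omega, show k - 1 ≠ 0 by omega]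
  · intro z h1 h2 h3
    rw [hζ, hone z h1 h2 h3, one_pow]
  · intro z
    rw [hζd, hpow]
    have h1 := mul_le_mul_of_nonneg_left (htime z)
      (mul_nonneg (Nat.cast_nonneg k) (pow_nonneg (hη0 z) (k - 1)))
    simp only [timeDir, _root_.smul_apply, smul_eq_mul]
    linarith
  · intro z a
    rw [hζd, hpow, sum_mul_apply_spaceDir]
    have h1 := mul_le_mul_of_nonneg_left (hspace z a)
      (mul_nonneg (Nat.cast_nonneg k) (pow_nonneg (hη0 z) (k - 1)))
    simp only [_root_.smul_apply, smul_eq_mul]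
    linarith

/-! ### A priori estimates for the difference -/

namespace IsDifferenceSystem

variable {n : ℕ} {p q K c : ℝ} {w wt G : SpaceTime n → ℝ} {A D : SpaceTime n → EuclideanSpace ℝ (Fin n)}

/-- Testing with `g(w) ζ`. -/
theorem comp_test (h : IsDifferenceSystem n p q K c w wt G A D) (hp : 1 < p)
    {g g' H : ℝ → ℝ} {M : ℝ} (hH : ∀ r, 0 ≤ r → HasDerivAt H (g r) r)
    (hg : ∀ r, 0 ≤ r → HasDerivAt g (g' r) r) (hgs : ∀ r, 0 ≤ r → ContDiffAt ℝ (⊤ : ℕ∞) g r)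
    (hg'c : ∀ r, 0 ≤ r → ContinuousAt g' r) (hg0 : ∀ r, 0 ≤ r → 0 ≤ g r)
    (hgM : ∀ r, 0 ≤ r → g r ≤ M) (hg'M : ∀ r, 0 ≤ r → |g' r| ≤ M)
    (ζ : TestFunction (halfSpace n) ℝ (⊤ : ℕ∞)) (hζ : ∀ z, 0 ≤ ζ z)
    {X Y : SpaceTime n → ℝ} (hX : IntegrableOn X (halfSpace n)) (hY : IntegrableOn Y (halfSpace n))
    (hXY : ∀ᵐ z ∂volume.restrict (halfSpace n : Set (SpaceTime n)),
      -(H (w z) * fderiv ℝ ζ z (timeDir n)) + g' (w z) * (∑ i, A z i * D z i) * ζ z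
        + g (w z) * ∑ i, A z i * fderiv ℝ ζ z (spaceDir i) - G z * g (w z) * ζ z ≤ Y z - X z) :
    ∫ z in halfSpace n, X z ≤ ∫ z in halfSpace n, Y z := by
  obtain ⟨h1, h2⟩ := integral_comp_test_nonneg (Real.HolderConjugate.conjExponent hp) h.weak_time
    h.weak_space h.grad_pow h.flux_loc h.flux_pow h.source_loc h.nonneg h.test hH hg hgs hg'c hg0 hgM
    hg'M ζ hζ
  have h3 : 0 ≤ ∫ z in halfSpace n, (Y z - X z) := by
    refine h2.trans (integral_mono_ae h1 (hY.sub hX) ?_)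
    filter_upwards [hXY] with z hz
    refine le_trans (le_of_eq ?_) hz
    simp_rw [mul_add, Finset.sum_add_distrib, Finset.mul_sum, Finset.sum_mul]
    have e1 : ∑ i, A z i * (g' (w z) * D z i * ζ z) = ∑ i, g' (w z) * (A z i * D z i) * ζ z :=
      Finset.sum_congr rfl fun i _ => by ring
    have e2 : ∑ i, A z i * (g (w z) * fderiv ℝ ζ z (spaceDir i))
        = ∑ i, g (w z) * (A z i * fderiv ℝ ζ z (spaceDir i)) :=
      Finset.sum_congr rfl fun i _ => by ring
    rw [e1, e2]
    ring
  rw [integral_sub hY hX] at h3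
  linarith

theorem aestronglyMeasurable (h : IsDifferenceSystem n p q K c w wt G A D) :
    AEStronglyMeasurable w (volume.restrict (halfSpace n : Set (SpaceTime n))) :=
  h.weak_time.1.aestronglyMeasurable

theorem locallyIntegrableOn_rpow (h : IsDifferenceSystem n p q K c w wt G A D) (hc : 0 < c) :
    LocallyIntegrableOn (fun z => w z ^ q) (halfSpace n) := by
  refine LocallyIntegrableOn.mono_of_ae_restrict (h.source_loc.smul c⁻¹)
    (h.aestronglyMeasurable.aemeasurable.pow_const _).aestronglyMeasurable ?_
  filter_upwards [h.source_ge, h.nonneg] with z h1 h2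
  rw [abs_of_nonneg (Real.rpow_nonneg h2 _), Pi.smul_apply, smul_eq_mul, inv_mul_eq_div,
    le_div_iff₀ hc]
  linarith

theorem locallyIntegrableOn_dissipation (h : IsDifferenceSystem n p q K c w wt G A D) (hp : 1 < p) :
    LocallyIntegrableOn (fun z => ∑ i, A z i * D z i) (halfSpace n) := by
  refine LocallyIntegrableOn.finsetSum _ fun i _ => ?_
  refine LocallyIntegrableOn.mono_of_ae_restrict ((h.grad_pow i).add (h.flux_pow i))
    ((h.flux_loc i).aestronglyMeasurable.mul (h.weak_space i).2.1.aestronglyMeasurable)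
    (Filter.Eventually.of_forall fun z => ?_)
  have hpp := Real.HolderConjugate.conjExponent hp
  have h3 := Real.young_inequality_of_nonneg (abs_nonneg (D z i)) (abs_nonneg (A z i)) hpp
  have h4 : |D z i| ^ p / p ≤ |D z i| ^ p := div_le_self (by positivity) hpp.lt.le
  have h5 : |A z i| ^ p.conjExponent / p.conjExponent ≤ |A z i| ^ p.conjExponent :=
    div_le_self (by positivity) hpp.symm.lt.le
  rw [abs_mul, mul_comm]
  exact h3.trans (add_le_add h4 h5)

theorem locallyIntegrableOn_weighted_dissipation (h : IsDifferenceSystem n p q K c w wt G A D)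
    (hp : 1 < p) {s ε : ℝ} (hs : 0 ≤ s) (hε : 0 < ε) :
    LocallyIntegrableOn (fun z => (w z + ε) ^ (-s - 1) * ∑ i, A z i * D z i) (halfSpace n) := by
  have hF := h.locallyIntegrableOn_dissipation hp
  refine LocallyIntegrableOn.mono_of_ae_restrict (hF.smul (ε ^ (-s - 1)))
    (((h.aestronglyMeasurable.aemeasurable.add_const ε).pow_const _).aestronglyMeasurable.mul
      hF.aestronglyMeasurable) ?_
  filter_upwards [h.nonneg] with z hz
  have h0 := h.dissipation_nonneg z
  have h1 : (w z + ε) ^ (-s - 1) ≤ ε ^ (-s - 1) :=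
    Real.rpow_le_rpow_of_nonpos hε (by linarith) (by linarith)
  rw [abs_of_nonneg (by positivity), Pi.smul_apply, smul_eq_mul]
  gcongr

variable {s r l B T R τ : ℝ} {k : ℕ} {ζ : TestFunction (halfSpace n) ℝ (⊤ : ℕ∞)}
  {η : SpaceTime n → ℝ}

theorem integrableOn_weighted_dissipation_mul (h : IsDifferenceSystem n p q K c w wt G A D)
    (hp : 1 < p) {ε : ℝ} (hs : 0 ≤ s) (hε : 0 < ε) (ζ : TestFunction (halfSpace n) ℝ (⊤ : ℕ∞)) :
    IntegrableOn (fun z => (w z + ε) ^ (-s - 1) * (∑ i, A z i * D z i) * ζ z) (halfSpace n) :=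
  (h.locallyIntegrableOn_weighted_dissipation hp hs hε).integrableOn_mul_testFunction ζ

theorem integrableOn_rpow_mul (h : IsDifferenceSystem n p q K c w wt G A D) (hc : 0 < c)
    (ζ : TestFunction (halfSpace n) ℝ (⊤ : ℕ∞)) :
    IntegrableOn (fun z => w z ^ q * ζ z) (halfSpace n) :=
  (h.locallyIntegrableOn_rpow hc).integrableOn_mul_testFunction ζ

/-- The factor K + 1 serves only to share one constant with the flux bound `space_le`. -/
theorem time_le (hζ : IsScaledCutoff n k B T R τ ζ η) (hB : 0 ≤ B) (hK : 0 ≤ K)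
    (hr : 0 < r) (hT : T⁻¹ = r ^ (q - 1)) (z : SpaceTime n) :
    -fderiv ℝ ζ z (timeDir n) ≤ B * (K + 1) * r ^ (q - 1) * η z ^ ((k : ℝ) - 1) *
      (farRegion n T R).indicator 1 z := by
  refine (hζ.time_le z).trans ?_
  rw [hT]
  have h1 : 0 ≤ r ^ (q - 1) * η z ^ ((k : ℝ) - 1) * (farRegion n T R).indicator 1 z :=
    mul_nonneg (mul_nonneg (by positivity) (Real.rpow_nonneg (hζ.nonneg z) _))
      (Set.indicator_nonneg (fun _ _ => zero_le_one) _)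
  nlinarith [mul_nonneg (mul_nonneg hB hK) h1]

theorem space_le (h : IsDifferenceSystem n p q K c w wt G A D)
    (hζ : IsScaledCutoff n k B T R τ ζ η) (hB : 0 ≤ B) (hr : 0 < r)
    (hR : R⁻¹ = r ^ ((q - p + 1) / p)) (z : SpaceTime n) :
    ∑ i, A z i * fderiv ℝ ζ z (spaceDir i) ≤ B * (K + 1) * r ^ ((q - p + 1) / p) *
      (∑ i, A z i * D z i) ^ ((p - 1) / p) * η z ^ ((k : ℝ) - 1) *
      (farRegion n T R).indicator 1 z := by
  refine (hζ.space_le z (A z)).trans ?_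
  rw [hR]
  have hF := Real.rpow_nonneg (h.dissipation_nonneg z) ((p - 1) / p)
  have h1 : 0 ≤ η z ^ ((k : ℝ) - 1) := Real.rpow_nonneg (hζ.nonneg z) _
  have h2 : 0 ≤ (farRegion n T R).indicator (1 : SpaceTime n → ℝ) z :=
    Set.indicator_nonneg (fun _ _ => zero_le_one) _
  have h3 : ‖A z‖ ≤ (K + 1) * (∑ i, A z i * D z i) ^ ((p - 1) / p) := by
    linarith [h.flux_le z]
  calc _ ≤ B * r ^ ((q - p + 1) / p) * ((K + 1) * (∑ i, A z i * D z i) ^ ((p - 1) / p))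
        * η z ^ ((k : ℝ) - 1) * (farRegion n T R).indicator 1 z := by gcongr
    _ = _ := by ring

theorem indicator_one_le_one (S : Set (SpaceTime n)) (z : SpaceTime n) :
    S.indicator (1 : SpaceTime n → ℝ) z ≤ 1 :=
  Set.indicator_le_self' (fun _ _ => zero_le_one) z

theorem integrableOn_indicator_cylinder (C T R : ℝ) :
    IntegrableOn ((spaceTimeCylinder n T R).indicator fun _ => C) (halfSpace n) :=
  ((integrable_indicator_iff (isCompact_cylinder n T R).measurableSet).mpr
    (integrableOn_const (isCompact_cylinder n T R).measure_lt_top.ne)).integrableOn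

theorem integral_indicator_cylinder_le {C : ℝ} (hC : 0 ≤ C) (T R : ℝ) :
    ∫ z in halfSpace n, (spaceTimeCylinder n T R).indicator (fun _ => C) z ≤
      C * volume.real (spaceTimeCylinder n T R) := by
  have hm := (isCompact_cylinder n T R).measurableSet
  calc _ ≤ ∫ z, (spaceTimeCylinder n T R).indicator (fun _ => C) z :=
        setIntegral_le_integral ((integrable_indicator_iff hm).mpr
          (integrableOn_const (isCompact_cylinder n T R).measure_lt_top.ne))
          (Filter.Eventually.of_forall fun z => Set.indicator_nonneg (fun _ _ => hC) _)
    _ = _ := by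
        rw [integral_indicator hm, setIntegral_const, smul_eq_mul, mul_comm]

/-- Scaling of the weighted dissipation. -/
theorem exists_integral_weighted_dissipation_le (he : AdmissibleExponents p q s k) (hc : 0 < c)
    (hK : 0 ≤ K) (hB : 0 ≤ B) (h : IsDifferenceSystem n p q K c w wt G A D) :
    ∃ C : ℝ, 0 ≤ C ∧ ∀ {r l T R τ ζ η}, 0 < r → 0 < l → l ≤ 1 → T⁻¹ = r ^ (q - 1) →
      R⁻¹ = r ^ ((q - p + 1) / p) → IsScaledCutoff n k B T R τ ζ η →
      r ^ s * ∫ z in halfSpace n, (w z + l * r) ^ (-s - 1) * (∑ i, A z i * D z i) * ζ z ≤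
        C * (r ^ q * volume.real (spaceTimeCylinder n T R)) := by
  have hp := he.one_lt_p
  have hs := he.s_pos
  have hs1 : 0 < 1 - s := by linarith [he.s_lt_p, he.p_le_two]
  have hk0 : (0 : ℝ) ≤ k := Nat.cast_nonneg k
  obtain ⟨C, hC0, hC⟩ := exists_weighted_absorption_scaled (k := k) (B := B * (K + 1)) (c := c)
    hp he.p_le_two hs he.s_lt_p he.s_lt_q he.le_k (by linarith [he.time_k])
    (by
      -- The unweighted condition on k is the stronger one: p(q - s) ≤ pq ≤ k(q - (s + 1)(p - 1)) ≤
      -- k(q - p + 1).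
      have h1 := he.space_k
      have h2 : (k : ℝ) * (q - (s + 1) * (p - 1)) ≤ k * (q - p + 1) := by
        gcongr
        nlinarith
      nlinarith)
    (by positivity) hc
  refine ⟨2 / s * C, by positivity, fun {r l T R τ ζ η} hr hl hl1 hT hR hζ => ?_⟩
  set ε := l * r with hε
  have hε0 : 0 < ε := by positivity
  have hζ0 : ∀ z, 0 ≤ ζ z := fun z => by
    rw [hζ.eq_rpow]; exact Real.rpow_nonneg (hζ.nonneg z) _
  have hi := h.integrableOn_weighted_dissipation_mul hp hs.le hε0 ζ
  have hda : ∀ (a x : ℝ), 0 ≤ x → HasDerivAt (fun x => (x + ε) ^ a) (a * (x + ε) ^ (a - 1)) x := by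
    intro a x hx
    simpa using ((hasDerivAt_id x).add_const ε).rpow_const (p := a) (Or.inl (by simp; linarith))
  have hle : ∀ (a x : ℝ), 0 ≤ x → a ≤ 0 → (x + ε) ^ a ≤ ε ^ a := fun a x hx ha =>
    Real.rpow_le_rpow_of_nonpos hε0 (by linarith) ha
  -- The shift ε > 0 keeps (x + ε)^(-s) and its derivative bounded on [0, ∞); M adds their bounds at
  -- x = 0.
  have key := h.comp_test hp (g := fun x => (x + ε) ^ (-s)) (g' := fun x => -s * (x + ε) ^ (-s - 1))
    (H := fun x => (x + ε) ^ (1 - s) / (1 - s)) (M := ε ^ (-s) + s * ε ^ (-s - 1))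
    (fun x hx => by
      convert! (hda (1 - s) x hx).div_const (1 - s) using 1
      rw [show 1 - s - 1 = -s by ring]
      field_simp)
    (fun x hx => hda (-s) x hx)
    (fun x hx => (contDiffAt_id.add contDiffAt_const).rpow_const_of_ne (by simp; linarith))
    (fun x hx => ((hda (-s - 1) x hx).continuousAt).const_mul _)
    (fun x hx => Real.rpow_nonneg (by linarith) _)
    (fun x hx => by
      have := hle (-s) x hx (by linarith)
      have : 0 ≤ s * ε ^ (-s - 1) := by positivity
      linarith)
    (fun x hx => by
      have h1 := hle (-s - 1) x hx (by linarith)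
      have h2 : 0 ≤ (x + ε) ^ (-s - 1) := Real.rpow_nonneg (by linarith) _
      rw [abs_mul, abs_neg, abs_of_pos hs, abs_of_nonneg h2]
      have h3 : 0 ≤ ε ^ (-s) := by positivity
      nlinarith)
    ζ hζ0 (X := fun z => s / 2 * ((w z + ε) ^ (-s - 1) * (∑ i, A z i * D z i) * ζ z))
    (Y := (spaceTimeCylinder n T R).indicator fun _ => C * r ^ (q - s)) (hi.const_mul _)
    (integrableOn_indicator_cylinder _ _ _)
    (by
      filter_upwards [h.nonneg, h.source_ge] with z hw hG
      by_cases hz : z ∈ spaceTimeCylinder n T R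
      · have h1 := hC r l (w z) (∑ i, A z i * D z i) (η z) (fderiv ℝ ζ z (timeDir n))
          (∑ i, A z i * fderiv ℝ ζ z (spaceDir i)) (G z) hr hl hl1 hw (h.dissipation_nonneg z)
          (hζ.nonneg z) (hζ.le_one z)
          ((time_le hζ hB hK hr hT z).trans (mul_le_of_le_one_right
            (by have := hζ.nonneg z; positivity) (indicator_one_le_one _ z)))
          ((h.space_le hζ hB hr hR z).trans (mul_le_of_le_one_right
            (by have := hζ.nonneg z; have := h.dissipation_nonneg z; positivity)
            (indicator_one_le_one _ z))) hG
        rw [Set.indicator_of_mem hz]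
        rw [← hζ.eq_rpow] at h1
        linarith
      · obtain ⟨h1, h2⟩ := hζ.eq_zero z hz
        rw [Set.indicator_of_notMem hz]
        simp [h1, h2])
  have h2 := key.trans (integral_indicator_cylinder_le (by positivity) T R)
  rw [integral_const_mul] at h2
  have e : r ^ s * r ^ (q - s) = r ^ q := by rw [← Real.rpow_add hr]; ring_nf
  set I := ∫ z in halfSpace n, (w z + ε) ^ (-s - 1) * (∑ i, A z i * D z i) * ζ z with hI
  have h3 : I ≤ 2 / s * (C * r ^ (q - s) * volume.real (spaceTimeCylinder n T R)) := by
    calc I = 2 / s * (s / 2 * I) := by field_simp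
      _ ≤ _ := by gcongr
  calc r ^ s * I ≤ r ^ s * (2 / s * (C * r ^ (q - s) * volume.real (spaceTimeCylinder n T R))) := by gcongr
    _ = 2 / s * C * ((r ^ s * r ^ (q - s)) * volume.real (spaceTimeCylinder n T R)) := by ring
    _ = _ := by rw [e]

theorem comp_test_one (h : IsDifferenceSystem n p q K c w wt G A D) (hp : 1 < p)
    (ζ : TestFunction (halfSpace n) ℝ (⊤ : ℕ∞)) (hζ : ∀ z, 0 ≤ ζ z)
    {X Y : SpaceTime n → ℝ} (hX : IntegrableOn X (halfSpace n)) (hY : IntegrableOn Y (halfSpace n))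
    (hXY : ∀ᵐ z ∂volume.restrict (halfSpace n : Set (SpaceTime n)),
      -(w z * fderiv ℝ ζ z (timeDir n)) + ∑ i, A z i * fderiv ℝ ζ z (spaceDir i) - G z * ζ z
        ≤ Y z - X z) :
    ∫ z in halfSpace n, X z ≤ ∫ z in halfSpace n, Y z := by
  refine h.comp_test hp (g := fun _ => 1) (g' := fun _ => 0) (H := fun x => x) (M := 1)
    (fun x _ => hasDerivAt_id' x) (fun x _ => hasDerivAt_const x 1) (fun _ _ => contDiffAt_const)
    (fun _ _ => continuousAt_const) (fun _ _ => zero_le_one) (fun _ _ => le_rfl)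
    (fun _ _ => by simp) ζ hζ hX hY ?_
  filter_upwards [hXY] with z hz
  linarith

/-- The dissipation left over by the unweighted test is exactly what the weighted test bounds; the
shift l = 1 is good enough here. -/
theorem exists_integral_rpow_le (he : AdmissibleExponents p q s k) (hc : 0 < c)
    (hK : 0 ≤ K) (hB : 0 ≤ B) (h : IsDifferenceSystem n p q K c w wt G A D) :
    ∃ C : ℝ, 0 ≤ C ∧ ∀ {r T R τ ζ η}, 0 < r → T⁻¹ = r ^ (q - 1) →
      R⁻¹ = r ^ ((q - p + 1) / p) → IsScaledCutoff n k B T R τ ζ η →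
      ∫ z in halfSpace n, w z ^ q * ζ z ≤ C * (r ^ q * volume.real (spaceTimeCylinder n T R)) := by
  have hp := he.one_lt_p
  obtain ⟨C₁, hC₁0, hC₁⟩ := exists_integral_weighted_dissipation_le he hc hK hB h
  obtain ⟨C, hC0, hC⟩ := exists_unweighted_absorption_scaled (k := k) (B := B * (K + 1)) (c := c)
    hp he.one_lt_q he.s_pos he.weight_lt he.le_k he.time_k he.space_k (by positivity) hc
  refine ⟨2 / c * (C₁ + C), by positivity, fun {r T R τ ζ η} hr hT hR hζ => ?_⟩
  have hζ0 : ∀ z, 0 ≤ ζ z := fun z => by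
    rw [hζ.eq_rpow]; exact Real.rpow_nonneg (hζ.nonneg z) _
  have hi := h.integrableOn_weighted_dissipation_mul hp he.s_pos.le
    (by positivity : 0 < 1 * r) ζ
  have hYi : IntegrableOn (fun z => r ^ s * ((w z + 1 * r) ^ (-s - 1) * (∑ i, A z i * D z i) * ζ z)
      + (spaceTimeCylinder n T R).indicator (fun _ => C * r ^ q) z) (halfSpace n) :=
    (hi.const_mul _).add (integrableOn_indicator_cylinder _ _ _)
  have key := h.comp_test_one hp ζ hζ0 (X := fun z => c / 2 * (w z ^ q * ζ z))
    ((h.integrableOn_rpow_mul hc ζ).const_mul _) hYi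
    (by
      filter_upwards [h.nonneg, h.source_ge] with z hw hG
      by_cases hz : z ∈ spaceTimeCylinder n T R
      · have h1 := hC r 1 (w z) (∑ i, A z i * D z i) (η z) (fderiv ℝ ζ z (timeDir n))
          (∑ i, A z i * fderiv ℝ ζ z (spaceDir i)) (G z) hr one_pos le_rfl hw
          (h.dissipation_nonneg z) (hζ.nonneg z) (hζ.le_one z)
          ((time_le hζ hB hK hr hT z).trans (mul_le_of_le_one_right
            (by have := hζ.nonneg z; positivity) (indicator_one_le_one _ z)))
          ((h.space_le hζ hB hr hR z).trans (mul_le_of_le_one_right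
            (by have := hζ.nonneg z; have := h.dissipation_nonneg z; positivity)
            (indicator_one_le_one _ z))) hG
        rw [Set.indicator_of_mem hz]
        rw [← hζ.eq_rpow] at h1
        linarith
      · obtain ⟨h1, h2⟩ := hζ.eq_zero z hz
        rw [Set.indicator_of_notMem hz]
        simp [h1, h2])
  rw [integral_const_mul, integral_add (hi.const_mul _) (integrableOn_indicator_cylinder _ _ _),
    integral_const_mul] at key
  have h2 := integral_indicator_cylinder_le (n := n) (C := C * r ^ q) (by positivity) T R
  have h3 := hC₁ hr one_pos le_rfl hT hR hζ
  set I := ∫ z in halfSpace n, w z ^ q * ζ z with hI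
  calc I = 2 / c * (c / 2 * I) := by field_simp
    _ ≤ 2 / c * (C₁ * (r ^ q * volume.real (spaceTimeCylinder n T R))
        + C * r ^ q * volume.real (spaceTimeCylinder n T R)) := by
        gcongr
        linarith
    _ = _ := by ring

/-- The refinement for the critical exponent: the volume term acquires an arbitrarily small factor,
at the price of a large multiple of the integral of w^q where the cutoff may decrease. -/
theorem exists_integral_rpow_le_far (he : AdmissibleExponents p q s k) (hc : 0 < c)
    (hK : 0 ≤ K) (hB : 0 ≤ B) (h : IsDifferenceSystem n p q K c w wt G A D)
    (hw : IntegrableOn (fun z => w z ^ q) (halfSpace n)) {κ : ℝ} (hκ : 0 < κ) :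
    ∃ C : ℝ, 0 ≤ C ∧ ∀ {r T R τ ζ η}, 0 < r → T⁻¹ = r ^ (q - 1) →
      R⁻¹ = r ^ ((q - p + 1) / p) → IsScaledCutoff n k B T R τ ζ η →
      ∫ z in halfSpace n, w z ^ q * ζ z ≤ κ * (r ^ q * volume.real (spaceTimeCylinder n T R))
        + C * ∫ z in halfSpace n, (farRegion n T R).indicator (fun z => w z ^ q) z := by
  have hp := he.one_lt_p
  obtain ⟨C₁, hC₁0, hC₁⟩ := exists_integral_weighted_dissipation_le he hc hK hB h
  -- Chosen so that κ'(C₁ + 1) = κ c. The choice is not circular: l depends on κ', but C₁ is uniform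
  -- over all shifts l in (0, 1].
  set κ' := κ * c / (C₁ + 1) with hκ'
  have hκ'0 : 0 < κ' := by positivity
  obtain ⟨l, hl, hl1, C, hC0, hC⟩ := exists_annular_absorption_scaled (q := q) (k := k)
    (B := B * (K + 1)) (c := c) hp he.one_lt_q he.s_pos he.weight_lt he.le_k (by positivity) hκ'0
  refine ⟨C / c, by positivity, fun {r T R τ ζ η} hr hT hR hζ => ?_⟩
  have hζ0 : ∀ z, 0 ≤ ζ z := fun z => by
    rw [hζ.eq_rpow]; exact Real.rpow_nonneg (hζ.nonneg z) _
  have hi := h.integrableOn_weighted_dissipation_mul hp he.s_pos.le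
    (by positivity : 0 < l * r) ζ
  have hfar : MeasurableSet (farRegion n T R) := by
    refine IsClosed.measurableSet ?_
    exact (isClosed_le continuous_const continuous_fst).union
      (isClosed_le continuous_const continuous_snd.norm)
  have i1 : IntegrableOn (fun z => κ' * (r ^ s * ((w z + l * r) ^ (-s - 1) * (∑ i, A z i * D z i)
      * ζ z))) (halfSpace n) := (hi.const_mul _).const_mul _
  have i2 : IntegrableOn ((spaceTimeCylinder n T R).indicator fun _ => κ' * r ^ q) (halfSpace n) :=
    integrableOn_indicator_cylinder _ _ _
  have i3 : IntegrableOn (fun z => C * (farRegion n T R).indicator (fun z => w z ^ q) z)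
      (halfSpace n) := (hw.indicator hfar).const_mul _
  have key := h.comp_test_one hp ζ hζ0 (X := fun z => c * (w z ^ q * ζ z))
    (Y := fun z => κ' * (r ^ s * ((w z + l * r) ^ (-s - 1) * (∑ i, A z i * D z i) * ζ z))
      + (spaceTimeCylinder n T R).indicator (fun _ => κ' * r ^ q) z
      + C * (farRegion n T R).indicator (fun z => w z ^ q) z)
    ((h.integrableOn_rpow_mul hc ζ).const_mul _) ((i1.add i2).add i3)
    (by
      filter_upwards [h.nonneg, h.source_ge] with z hw hG
      have hχ : (farRegion n T R).indicator (fun z => w z ^ q) z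
          = w z ^ q * (farRegion n T R).indicator 1 z := by
        by_cases hz : z ∈ farRegion n T R <;> simp [hz]
      rw [hχ]
      by_cases hz : z ∈ spaceTimeCylinder n T R
      · have h1 := hC r (w z) (∑ i, A z i * D z i) (η z) (fderiv ℝ ζ z (timeDir n))
          (∑ i, A z i * fderiv ℝ ζ z (spaceDir i)) (G z) ((farRegion n T R).indicator 1 z) hr hw
          (h.dissipation_nonneg z) (hζ.nonneg z) (hζ.le_one z)
          (by by_cases hz : z ∈ farRegion n T R <;> simp [hz])
          (time_le hζ hB hK hr hT z) (h.space_le hζ hB hr hR z) hG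
        rw [Set.indicator_of_mem hz]
        rw [← hζ.eq_rpow] at h1
        linarith
      · obtain ⟨h1, h2⟩ := hζ.eq_zero z hz
        rw [Set.indicator_of_notMem hz]
        have h3 : 0 ≤ C * (w z ^ q * (farRegion n T R).indicator 1 z) :=
          mul_nonneg hC0 (mul_nonneg (Real.rpow_nonneg hw _)
            (Set.indicator_nonneg (fun _ _ => zero_le_one) _))
        simpa [h1, h2] using h3)
  have i12 : IntegrableOn (fun z =>
      κ' * (r ^ s * ((w z + l * r) ^ (-s - 1) * (∑ i, A z i * D z i) * ζ z))
      + (spaceTimeCylinder n T R).indicator (fun _ => κ' * r ^ q) z) (halfSpace n) := i1.add i2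
  rw [integral_const_mul, integral_add i12 i3, integral_add i1 i2, integral_const_mul,
    integral_const_mul, integral_const_mul] at key
  have h2 := integral_indicator_cylinder_le (n := n) (C := κ' * r ^ q) (by positivity) T R
  have h3 := mul_le_mul_of_nonneg_left (hC₁ hr hl hl1 hT hR hζ) hκ'0.le
  set I := ∫ z in halfSpace n, w z ^ q * ζ z with hI
  set J := ∫ z in halfSpace n, (farRegion n T R).indicator (fun z => w z ^ q) z with hJ
  have h4 : κ' * (C₁ * (r ^ q * volume.real (spaceTimeCylinder n T R)))
      + κ' * r ^ q * volume.real (spaceTimeCylinder n T R)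
      = κ * c * (r ^ q * volume.real (spaceTimeCylinder n T R)) := by
    rw [hκ']; field_simp
  have h5 : c * I ≤ c * (κ * (r ^ q * volume.real (spaceTimeCylinder n T R)) + C / c * J) := by
    have : c * (C / c * J) = C * J := by field_simp
    rw [mul_add, this]
    linarith
  exact le_of_mul_le_mul_left h5 hc

end IsDifferenceSystem

/-! ### Vanishing of the difference -/

section Vanishing

open Filter Topology

/-- With r = R^(-β) and T = r^(1-q) one has r^q T R^n = r R^n = R^(n-β) ≤ 1. -/
theorem rpow_mul_volume_real_spaceTimeCylinder_le {n : ℕ} {q β R : ℝ} (hβ : n ≤ β) (hR : 1 ≤ R) :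
    (R ^ (-β)) ^ q * volume.real (spaceTimeCylinder n ((R ^ (-β)) ^ (1 - q)) R) ≤
      2 * 2 ^ n * volume.real (Metric.ball (0 : EuclideanSpace ℝ (Fin n)) 1) := by
  have hR0 : 0 < R := by linarith
  set r := R ^ (-β) with hr
  have hr0 : 0 < r := by positivity
  have h1 : r ^ q * r ^ (1 - q) = r := by
    rw [← Real.rpow_add hr0, show q + (1 - q) = 1 by ring, Real.rpow_one]
  have h2 : r * R ^ n ≤ 1 := by
    rw [hr, ← Real.rpow_natCast R n, ← Real.rpow_add hR0]
    exact Real.rpow_le_one_of_one_le_of_nonpos hR (by linarith)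
  rw [volume_real_cylinder n (by positivity) hR0.le, mul_pow]
  set ω := volume.real (Metric.ball (0 : EuclideanSpace ℝ (Fin n)) 1) with hω
  calc _ = r ^ q * r ^ (1 - q) * R ^ n * (2 * 2 ^ n * ω) := by ring
    _ = r * R ^ n * (2 * 2 ^ n * ω) := by rw [h1]
    _ ≤ 1 * (2 * 2 ^ n * ω) := by gcongr
    _ = _ := one_mul _

/-- At or below the critical exponent the difference of ordered solutions vanishes. -/
theorem IsDifferenceSystem.ae_eq_zero {n : ℕ} {p q K c : ℝ} {w wt G : SpaceTime n → ℝ}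
    {A D : SpaceTime n → EuclideanSpace ℝ (Fin n)} (hn : 1 ≤ n) (hp : 1 < p) (hp2 : p ≤ 2)
    (hq : 1 < q) (hqp : q ≤ p - 1 + p / n) (hc : 0 < c) (hK : 0 ≤ K)
    (h : IsDifferenceSystem n p q K c w wt G A D) :
    ∀ᵐ z ∂volume.restrict (halfSpace n : Set (SpaceTime n)), w z = 0 := by
  obtain ⟨s, k, he⟩ := exists_admissibleExponents hp hp2 hq
  have hk2 : 2 ≤ k := by
    have h1 : (1 : ℝ) < k := hp.trans_le he.le_k
    exact_mod_cast h1
  obtain ⟨B, hB0, hB⟩ := exists_isScaledCutoff n k hk2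
  have hd : 0 < q - p + 1 := by linarith
  set β := p / (q - p + 1) with hβ
  have hβ0 : 0 < β := by positivity
  -- The only use of the upper bound on q: it is equivalent to n ≤ p/(q - p + 1).
  have hnβ : (n : ℝ) ≤ β := by
    have hn0 : (0 : ℝ) < n := by exact_mod_cast hn
    rw [hβ, le_div_iff₀ hd]
    have h1 : q - p + 1 ≤ p / n := by linarith
    rw [le_div_iff₀ hn0] at h1
    linarith
  set R : ℕ → ℝ := fun m => m + 1 with hR
  have hR1 : ∀ m, 1 ≤ R m := fun m => by simp [hR]
  have hR0 : ∀ m, 0 < R m := fun m => by linarith [hR1 m]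
  have hRlim : Tendsto R atTop atTop :=
    tendsto_atTop_add_const_right _ _ tendsto_natCast_atTop_atTop
  set r : ℕ → ℝ := fun m => R m ^ (-β) with hr
  have hr0 : ∀ m, 0 < r m := fun m => Real.rpow_pos_of_pos (hR0 m) _
  set T : ℕ → ℝ := fun m => r m ^ (1 - q) with hT
  have hT0 : ∀ m, 0 < T m := fun m => Real.rpow_pos_of_pos (hr0 m) _
  have hTlim : Tendsto T atTop atTop := by
    have e : T = fun m => R m ^ (β * (q - 1)) := by
      ext m
      simp only [hT, hr]
      rw [← Real.rpow_mul (hR0 m).le]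
      congr 1; ring
    rw [e]
    exact (tendsto_rpow_atTop (mul_pos hβ0 (by linarith))).comp hRlim
  -- The starting time may tend to 0 at any rate, since no estimate involves it.
  set τ : ℕ → ℝ := fun m => (R m)⁻¹ with hτ
  have hτ0 : ∀ m, 0 < τ m := fun m => inv_pos.mpr (hR0 m)
  have hτlim : Tendsto τ atTop (𝓝 0) := tendsto_inv_atTop_zero.comp hRlim
  have hTr : ∀ m, (T m)⁻¹ = r m ^ (q - 1) := fun m => by
    simp only [hT]
    rw [← Real.rpow_neg (hr0 m).le]
    congr 1; ring
  have hRr : ∀ m, (R m)⁻¹ = r m ^ ((q - p + 1) / p) := fun m => by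
    simp only [hr]
    rw [← Real.rpow_mul (hR0 m).le, ← Real.rpow_neg_one]
    congr 1
    rw [hβ]; field_simp
  choose ζ η hζ using fun m => hB (T m) (R m) (τ m) (hT0 m) (hR0 m) (hτ0 m)
  set V : ℝ := 2 * 2 ^ n * volume.real (Metric.ball (0 : EuclideanSpace ℝ (Fin n)) 1) with hV
  have hV0 : 0 ≤ V := by positivity
  have hvol : ∀ m, r m ^ q * volume.real (spaceTimeCylinder n (T m) (R m)) ≤ V := fun m =>
    rpow_mul_volume_real_spaceTimeCylinder_le hnβ (hR1 m)
  -- The sets where the cutoffs equal 1; they exhaust the half-space.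
  set S : ℕ → Set (SpaceTime n) := fun m => {z | 2 * τ m ≤ z.1 ∧ z.1 ≤ T m ∧ ‖z.2‖ ≤ R m} with hS
  have hSm : ∀ m, MeasurableSet (S m) := fun m =>
    ((isClosed_le continuous_const continuous_fst).inter
      ((isClosed_le continuous_fst continuous_const).inter
        (isClosed_le continuous_snd.norm continuous_const))).measurableSet
  have hτ2 : Tendsto (fun m => 2 * τ m) atTop (𝓝 0) := by simpa using hτlim.const_mul 2
  have hcover : AECover (volume.restrict (halfSpace n : Set (SpaceTime n))) atTop S := by
    refine ⟨?_, hSm⟩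
    rw [ae_restrict_iff' (halfSpace n).isOpen.measurableSet]
    refine Eventually.of_forall fun z hz => ?_
    have hz0 : 0 < z.1 := hz.1
    filter_upwards [hτ2.eventually (gt_mem_nhds hz0), hTlim.eventually_ge_atTop z.1,
      hRlim.eventually_ge_atTop ‖z.2‖] with m h1 h2 h3 using ⟨h1.le, h2, h3⟩
  have hnn : ∀ᵐ z ∂volume.restrict (halfSpace n : Set (SpaceTime n)), 0 ≤ w z ^ q := by
    filter_upwards [h.nonneg] with z hz using Real.rpow_nonneg hz _
  have hint := fun m => h.integrableOn_rpow_mul hc (ζ m)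
  have hone : ∀ m, ∀ z ∈ S m, w z ^ q * ζ m z = w z ^ q := fun m z hz => by
    rw [(hζ m).eq_one z hz.1 hz.2.1 hz.2.2, mul_one]
  have hSint : ∀ m, IntegrableOn (fun z => w z ^ q) (S m)
      (volume.restrict (halfSpace n : Set (SpaceTime n))) := fun m =>
    ((hint m).integrable.integrableOn).congr_fun (fun z hz => hone m z hz) (hSm m)
  have hSle : ∀ m, ∫ z in S m, w z ^ q ∂(volume.restrict (halfSpace n : Set (SpaceTime n)))
      ≤ ∫ z in halfSpace n, w z ^ q * ζ m z := by
    intro m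
    rw [← setIntegral_congr_fun (hSm m) (hone m)]
    refine setIntegral_le_integral (hint m) ?_
    filter_upwards [hnn] with z hz
    refine mul_nonneg hz ?_
    rw [(hζ m).eq_rpow]
    exact Real.rpow_nonneg ((hζ m).nonneg z) _
  obtain ⟨C₀, hC₀, hbound⟩ := h.exists_integral_rpow_le he hc hK hB0
  -- The integrals over the exhausting sets are bounded by C₀ V, hence global integrability.
  have hw : IntegrableOn (fun z => w z ^ q) (halfSpace n) := by
    refine hcover.integrable_of_integral_bounded_of_nonneg_ae (C₀ * V) hSint hnn
      (Eventually.of_forall fun m => (hSle m).trans ?_)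
    refine (hbound (hr0 m) (hTr m) (hRr m) (hζ m)).trans ?_
    gcongr
    exact hvol m
  have hlim := hcover.integral_tendsto_of_countably_generated hw
  have hfar : Tendsto (fun m => ∫ z in halfSpace n,
      (farRegion n (T m) (R m)).indicator (fun z => w z ^ q) z) atTop (𝓝 0) := by
    have h0 : ∫ _ in (halfSpace n : Set (SpaceTime n)), (0 : ℝ) = 0 := by simp
    rw [← h0]
    refine tendsto_integral_of_dominated_convergence (fun z => w z ^ q) (fun m => ?_) hw
      (fun m => ?_) (Eventually.of_forall fun z => ?_)
    · refine hw.aestronglyMeasurable.indicator (IsClosed.measurableSet ?_)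
      exact (isClosed_le continuous_const continuous_fst).union
        (isClosed_le continuous_const continuous_snd.norm)
    · filter_upwards [hnn] with z hz
      by_cases hf : z ∈ farRegion n (T m) (R m)
      · rw [Set.indicator_of_mem hf, Real.norm_of_nonneg hz]
      · rwa [Set.indicator_of_notMem hf, norm_zero]
    · refine tendsto_const_nhds.congr' ?_
      filter_upwards [hTlim.eventually_gt_atTop z.1, hRlim.eventually_gt_atTop ‖z.2‖] with m h1 h2
      rw [Set.indicator_of_notMem]
      simp only [farRegion, Set.mem_ofPred_eq, not_or, not_le]
      exact ⟨h1, h2⟩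
  -- For fixed κ the far integral vanishes as m → ∞ despite its constant C, which depends on κ but
  -- not on m.
  have hle : ∀ κ : ℝ, 0 < κ → ∫ z in halfSpace n, w z ^ q ≤ κ * V := by
    intro κ hκ
    obtain ⟨C, hC0, hC⟩ := h.exists_integral_rpow_le_far he hc hK hB0 hw hκ
    have hup : Tendsto (fun m => κ * V + C * ∫ z in halfSpace n,
        (farRegion n (T m) (R m)).indicator (fun z => w z ^ q) z) atTop (𝓝 (κ * V)) := by
      simpa using (hfar.const_mul C).const_add (κ * V)
    refine le_of_tendsto_of_tendsto' hlim hup fun m => ?_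
    refine (hSle m).trans ((hC (hr0 m) (hTr m) (hRr m) (hζ m)).trans ?_)
    gcongr
    exact hvol m
  have hzero : ∫ z in halfSpace n, w z ^ q = 0 := by
    refine le_antisymm ?_ (integral_nonneg_of_ae hnn)
    refine le_of_forall_pos_le_add fun ε hε => ?_
    have h1 := hle (ε / (V + 1)) (by positivity)
    have h2 : ε / (V + 1) * V ≤ ε := by
      rw [div_mul_eq_mul_div, div_le_iff₀ (by positivity)]
      nlinarith
    linarith
  have hae := (integral_eq_zero_iff_of_nonneg_ae hnn hw).mp hzero
  filter_upwards [hae, h.nonneg] with z h1 h2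
  exact (Real.rpow_eq_zero h2 (by linarith)).mp h1

end Vanishing

theorem theorem1 (n : ℕ) (hn : 1 ≤ n) (p q : ℝ) (hp : 1 < p) (hp2 : p ≤ 2)
    (hq : 1 < q) (hqp : q ≤ p - 1 + p / n)
    (u v : SpaceTime n → ℝ)
    (hu : IsEntireWeakSuperSolution n p q u) (hv : IsEntireWeakSubSolution n p q v)
    (huv : ∀ᵐ z ∂volume.restrict (halfSpace n : Set (SpaceTime n)), v z ≤ u z) :
    ∀ᵐ z ∂volume.restrict (halfSpace n : Set (SpaceTime n)), u z = v z := by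
  obtain ⟨K, hK, wt, G, A, D, h⟩ := exists_isDifferenceSystem hp hp2 hq hu hv huv
  filter_upwards [h.ae_eq_zero hn hp hp2 hq hqp (by positivity) hK] with z hz
  linarith
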